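/- **Setting.** Let $S$ be a nonempty semitopological semigroup: a semigroup with a Hausdorff topology for which $s\mapsto ts$ and $s\mapsto st$ are continuous for every $t\in S$. Assume $S$ is *right reversible*: $\overline{Ss}\cap\overline{St}\neq\emptyset$ for all $s,t\in S$. (*Left reversible* means $\overline{sS}\cap\overline{tS}\neq\emptyset$ for all $s,t\in S$.) Let $C$ be a nonempty closed subset of a complex Hilbert space $H$, and let $\mathcal S=\{T_s:s\in S\}$ be a representation of $S$ on $C$, that is, maps $T_s:C\to C$ with $T_{st}=T_sT_t$, such that $(s,x)\mapsto T_sx$ is separately continuous in norm and $\|T_sx-T_sy\|\le\|x-y\|$ for all $s\in S$, $x,y\in C$. Suppose that $\{T_sc:s\in S\}$ is bounded for some $c\in C$. **Function spaces and means.** $C_b(S)$ is the Banach space of bounded continuous complex functions on $S$ with the supremum norm; $(\ell_sf)(t)=f(st)$ and $(r_sf)(t)=f(ts)$. $LUC(S)$ is the set of $f\in C_b(S)$ for which $s\mapsto\ell_sf$ is norm continuous; $AP(S)$ (resp. $WAP(S)$) is the set of $f\in C_b(S)$ for which $\{\ell_sf:s\in S\}$ is relatively compact in the norm (resp. weak)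 topology of $C_b(S)$. A mean on a translation-invariant subspace $X\ni 1$ of $C_b(S)$ is $\mu\in X^*$ with $\|\mu\|=\mu(1)=1$; it is a LIM if $\mu(\ell_sf)=\mu(f)$, and a RIM if $\mu(r_sf)=\mu(f)$, for all $s\in S$, $f\in X$. **Cases.** Let $X$ be one of the following; in cases (2)–(5) assume in addition that $C$ is weakly closed (which is automatic if $C$ is convex). 1. $X=C_b(S)$, and $s\mapsto T_sc$ is continuous from $S$ into $(C,\mathrm{wk})$; 2. $X=LUC(S)$, and $(s,x)\mapsto T_sx$ is jointly continuous from $S\times(C,\mathrm{wk})$ to $(C,\mathrm{wk})$; 3. $X=AP(S)$, and $\{T_s\}$ is equicontinuous on $(C,\mathrm{wk})$ (for the weak uniformity of $H$); 4. $X=WAP(S)$, and $\{T_s\}$ is quasi-equicontinuous on $(C,\mathrm{wk})$: every map in the closure of $\{T_s\}$ in the product space $(C,\mathrm{wk})^C$ is continuous on $(C,\mathrm{wk})$; 5. $X=AP(S)$, $S$ is left reversible and separable, and $\{T_s\}$ is equicontinuous on $(C,\mathrm{wk})$. **Theorem.** In case (5), $AP(S)$ has a LIM. In each of the cases (1)–(5),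 let $\mu$ be any LIM on $X$. Then: * the set $A_C(\mathcal S)=\{a\in H:\|a-T_sx\|\le\|a-x\|\text{ for all }s\in S,\ x\in C\}$ of attractive points is nonempty, closed and convex; * for every $x\in C$, each function $s\mapsto\varphi(T_sx)$, $\varphi\in H^*$, belongs to $X$, there is a unique $T_\mu x\in H$ with $\varphi(T_\mu x)=\mu_s(\varphi(T_sx))$ for all $\varphi\in H^*$, and $T_\mu x\in A_C(\mathcal S)$; * if $C$ is convex, then $S$ has a common fixed point in $C$, i.e. $F(\mathcal S)=\{x\in C:T_sx=x\ \text{for all}\ s\in S\}\neq\emptyset$; * if $\mu$ is also a RIM on $X$, then for every $x\in C$, $\lim_tP_{A_C(\mathcal S)}(T_tx)=T_\mu x$ in norm, where $P_{A_C(\mathcal S)}$ is the metric projection of $H$ onto $A_C(\mathcal S)$ and the limit is that of the net indexed by $S$ with the (directed) order $a\le b\iff\overline{Sa}\cup\{a\}\supseteq\overline{Sb}\cup\{b\}$. -/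

import Mathlib

open Set Filter Topology
open scoped BoundedContinuousFunction

noncomputable section

/-! ## Semitopological semigroups and function spaces on them -/

section Semigroup

variable {S : Type*} [Semigroup S] [TopologicalSpace S]

/-- Any two closed right ideals `closure (s S)`, `closure (t S)` meet. -/
def IsLeftReversible (S : Type*) [Semigroup S] [TopologicalSpace S] : Prop :=
  ∀ s t : S, (closure (range fun u : S => s * u) ∩ closure (range fun u : S => t * u)).Nonempty

/-- Any two closed left ideals `closure (S s)`, `closure (S t)` meet. -/
def IsRightReversible (S : Type*) [Semigroup S] [TopologicalSpace S] : Prop :=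
  ∀ s t : S, (closure (range fun u : S => u * s) ∩ closure (range fun u : S => u * t)).Nonempty

/-- The order `a ≤ b` iff `closure (S a) ∪ {a} ⊇ closure (S b) ∪ {b}` (directed when `S` is
right reversible). -/
def ReversibleLE (a b : S) : Prop :=
  closure (range fun u : S => u * b) ∪ {b} ⊆ closure (range fun u : S => u * a) ∪ {a}

/-- `lim_t f t = l` along `S` ordered by `ReversibleLE`, in the sense of nets. -/
def ReversibleTendsto {E : Type*} [TopologicalSpace E] (f : S → E) (l : E) : Prop :=
  ∀ U ∈ 𝓝 l, ∃ a : S, ∀ b : S, ReversibleLE a b → f b ∈ U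

variable [SeparatelyContinuousMul S]

/-- Left translate `(ℓ_s f)(t) = f (s t)` of `f ∈ C_b(S)`. -/
def leftTranslate (s : S) (f : S →ᵇ ℂ) : S →ᵇ ℂ :=
  f.compContinuous ⟨fun t => s * t, SeparatelyContinuousMul.continuous_const_mul⟩

/-- Right translate `(r_s f)(t) = f (t s)` of `f ∈ C_b(S)`. -/
def rightTranslate (s : S) (f : S →ᵇ ℂ) : S →ᵇ ℂ :=
  f.compContinuous ⟨fun t => t * s, SeparatelyContinuousMul.continuous_mul_const⟩

@[simp] theorem leftTranslate_apply (s t : S) (f : S →ᵇ ℂ) : leftTranslate s f t = f (s * t) := rfl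

@[simp] theorem rightTranslate_apply (s t : S) (f : S →ᵇ ℂ) :
    rightTranslate s f t = f (t * s) := rfl

theorem leftTranslate_add (s : S) (f g : S →ᵇ ℂ) :
    leftTranslate s (f + g) = leftTranslate s f + leftTranslate s g := rfl

theorem leftTranslate_smul (s : S) (z : ℂ) (f : S →ᵇ ℂ) :
    leftTranslate s (z • f) = z • leftTranslate s f := rfl

theorem leftTranslate_zero (s : S) : leftTranslate s (0 : S →ᵇ ℂ) = 0 := rfl

/-- `LUC(S)`: those `f ∈ C_b(S)` for which `s ↦ ℓ_s f` is norm continuous. -/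
def LUC (S : Type*) [Semigroup S] [TopologicalSpace S] [SeparatelyContinuousMul S] :
    Submodule ℂ (S →ᵇ ℂ) where
  carrier := {f | Continuous fun s : S => leftTranslate s f}
  add_mem' hf hg := by
    simp only [mem_ofPred_eq, leftTranslate_add] at *
    exact hf.add hg
  zero_mem' := by
    simp only [mem_ofPred_eq, leftTranslate_zero]
    exact continuous_const
  smul_mem' z f hf := by
    simp only [mem_ofPred_eq, leftTranslate_smul] at *
    exact hf.const_smul z

/-- `AP(S)`: those `f ∈ C_b(S)` whose set of left translates is relatively norm compact. -/
def AP (S : Type*) [Semigroup S] [TopologicalSpace S] [SeparatelyContinuousMul S] :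
    Submodule ℂ (S →ᵇ ℂ) where
  carrier := {f | IsCompact (closure (range fun s : S => leftTranslate s f))}
  add_mem' {f g} hf hg := by
    refine (hf.add hg).closure_of_subset ?_
    rintro _ ⟨s, rfl⟩
    exact ⟨_, subset_closure ⟨s, rfl⟩, _, subset_closure ⟨s, rfl⟩, rfl⟩
  zero_mem' := by
    refine isCompact_singleton (x := (0 : S →ᵇ ℂ)).closure_of_subset ?_
    rintro _ ⟨s, rfl⟩
    rfl
  smul_mem' z f hf := by
    refine (hf.image (continuous_const_smul z)).closure_of_subset ?_
    rintro _ ⟨s, rfl⟩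
    exact ⟨_, subset_closure ⟨s, rfl⟩, rfl⟩

instance weakSpace_t2 (E : Type*) [NormedAddCommGroup E] [NormedSpace ℂ E] :
    T2Space (WeakSpace ℂ E) := by
  refine (WeakBilin.isEmbedding (B := (topDualPairing ℂ E).flip) ?_).t2Space
  intro x y h
  refine (SeparatingDual.eq_iff_forall_dual_eq (R := ℂ)).2 fun g => ?_
  exact LinearMap.congr_fun h g

/-- `WAP(S)`: those `f ∈ C_b(S)` whose set of left translates is relatively compact in the weak
topology of the Banach space `C_b(S)`. -/
def WAP (S : Type*) [Semigroup S] [TopologicalSpace S] [SeparatelyContinuousMul S] :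
    Submodule ℂ (S →ᵇ ℂ) where
  carrier := {f | IsCompact
    (closure (range fun s : S => toWeakSpace ℂ (S →ᵇ ℂ) (leftTranslate s f)))}
  add_mem' {f g} hf hg := by
    refine (hf.add hg).closure_of_subset ?_
    rintro _ ⟨s, rfl⟩
    exact ⟨_, subset_closure ⟨s, rfl⟩, _, subset_closure ⟨s, rfl⟩, rfl⟩
  zero_mem' := by
    refine isCompact_singleton (x := (0 : WeakSpace ℂ (S →ᵇ ℂ))).closure_of_subset ?_
    rintro _ ⟨s, rfl⟩
    rfl
  smul_mem' z f hf := by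
    refine (hf.image (continuous_const_smul z)).closure_of_subset ?_
    rintro _ ⟨s, rfl⟩
    exact ⟨_, subset_closure ⟨s, rfl⟩, rfl⟩

/-- A mean on a subspace `X` of `C_b(S)`: a functional `m ∈ X*` with `‖m‖ = m(1) = 1`. -/
def IsMean (X : Submodule ℂ (S →ᵇ ℂ)) (m : X →L[ℂ] ℂ) : Prop :=
  ‖m‖ = 1 ∧ ∃ h : (1 : S →ᵇ ℂ) ∈ X, m ⟨1, h⟩ = 1

/-- A left invariant mean on `X`. (The spaces below are invariant under translations, so `h` is
automatic for them.) -/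
def IsLIM (X : Submodule ℂ (S →ᵇ ℂ)) (m : X →L[ℂ] ℂ) : Prop :=
  IsMean X m ∧ ∀ (s : S) (f : X) (h : leftTranslate s (f : S →ᵇ ℂ) ∈ X),
    m ⟨leftTranslate s f, h⟩ = m f

/-- A right invariant mean on `X`. -/
def IsRIM (X : Submodule ℂ (S →ᵇ ℂ)) (m : X →L[ℂ] ℂ) : Prop :=
  IsMean X m ∧ ∀ (s : S) (f : X) (h : rightTranslate s (f : S →ᵇ ℂ) ∈ X),
    m ⟨rightTranslate s f, h⟩ = m f

theorem leftTranslate_leftTranslate (s a : S) (f : S →ᵇ ℂ) :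
    leftTranslate s (leftTranslate a f) = leftTranslate (a * s) f := by
  ext t; simp [mul_assoc]

theorem leftTranslate_rightTranslate (s a : S) (f : S →ᵇ ℂ) :
    leftTranslate s (rightTranslate a f) = rightTranslate a (leftTranslate s f) := by
  ext t; simp [mul_assoc]

/-- Right translation as a bounded operator. -/
def rightTranslateCLM (a : S) : (S →ᵇ ℂ) →L[ℂ] (S →ᵇ ℂ) :=
  LinearMap.mkContinuous
    { toFun := rightTranslate a, map_add' := fun _ _ => rfl, map_smul' := fun _ _ => rfl } 1
    (fun f => by
      rw [one_mul]
      exact (BoundedContinuousFunction.norm_le (norm_nonneg _)).2 fun t => f.norm_coe_le_norm _)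

theorem one_mem_LUC : (1 : S →ᵇ ℂ) ∈ LUC S :=
  (continuous_const : Continuous fun _ : S => (1 : S →ᵇ ℂ))

theorem one_mem_AP : (1 : S →ᵇ ℂ) ∈ AP S := by
  refine isCompact_singleton (x := (1 : S →ᵇ ℂ)).closure_of_subset ?_
  rintro _ ⟨s, rfl⟩
  rfl

theorem one_mem_WAP : (1 : S →ᵇ ℂ) ∈ WAP S := by
  refine isCompact_singleton (x := toWeakSpace ℂ (S →ᵇ ℂ) 1).closure_of_subset ?_
  rintro _ ⟨s, rfl⟩
  rfl

theorem leftTranslate_mem_LUC (a : S) {f : S →ᵇ ℂ} (hf : f ∈ LUC S) :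
    leftTranslate a f ∈ LUC S := by
  change Continuous fun s : S => leftTranslate s (leftTranslate a f)
  simp only [leftTranslate_leftTranslate]
  exact Continuous.comp (g := fun s : S => leftTranslate s f) hf
    SeparatelyContinuousMul.continuous_const_mul

theorem rightTranslate_mem_LUC (a : S) {f : S →ᵇ ℂ} (hf : f ∈ LUC S) :
    rightTranslate a f ∈ LUC S := by
  change Continuous fun s : S => leftTranslate s (rightTranslate a f)
  simp only [leftTranslate_rightTranslate]
  exact (rightTranslateCLM a).continuous.comp hf

theorem leftTranslate_mem_AP (a : S) {f : S →ᵇ ℂ} (hf : f ∈ AP S) :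
    leftTranslate a f ∈ AP S := by
  refine IsCompact.closure_of_subset hf ?_
  rintro _ ⟨s, rfl⟩
  exact subset_closure ⟨a * s, (leftTranslate_leftTranslate s a f).symm⟩

theorem rightTranslate_mem_AP (a : S) {f : S →ᵇ ℂ} (hf : f ∈ AP S) :
    rightTranslate a f ∈ AP S := by
  refine (IsCompact.image hf (rightTranslateCLM a).continuous).closure_of_subset ?_
  rintro _ ⟨s, rfl⟩
  exact ⟨_, subset_closure ⟨s, rfl⟩, (leftTranslate_rightTranslate s a f).symm⟩

theorem leftTranslate_mem_WAP (a : S) {f : S →ᵇ ℂ} (hf : f ∈ WAP S) :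
    leftTranslate a f ∈ WAP S := by
  refine IsCompact.closure_of_subset hf ?_
  rintro _ ⟨s, rfl⟩
  exact subset_closure ⟨a * s, congrArg _ (leftTranslate_leftTranslate s a f).symm⟩

theorem rightTranslate_mem_WAP (a : S) {f : S →ᵇ ℂ} (hf : f ∈ WAP S) :
    rightTranslate a f ∈ WAP S := by
  refine (IsCompact.image hf
    (WeakSpace.map (rightTranslateCLM a)).continuous).closure_of_subset ?_
  rintro _ ⟨s, rfl⟩
  exact ⟨_, subset_closure ⟨s, rfl⟩,
    congrArg (toWeakSpace ℂ (S →ᵇ ℂ)) (leftTranslate_rightTranslate s a f).symm⟩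

end Semigroup

/-! ## Actions on a subset of a Hilbert space -/

section Action

variable {S : Type*} [TopologicalSpace S]
variable {H : Type*} [NormedAddCommGroup H] [InnerProductSpace ℂ H]

/-- The topology of `C` as a subspace of `(H, wk)`. -/
@[reducible] def weakTopology (C : Set H) : TopologicalSpace C :=
  TopologicalSpace.induced (fun x : C => toWeakSpace ℂ H (x : H)) inferInstance

/-- `C` is closed in the weak topology of `H`. -/
def IsWeaklyClosed (C : Set H) : Prop := IsClosed (toWeakSpace ℂ H '' C)

/-- `(s, x) ↦ T_s x` is continuous from `S × (C, wk)` to `(C, wk)`. -/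
def IsWeaklyJointlyContinuous {C : Set H} (T : S → C → C) : Prop :=
  Continuous[@instTopologicalSpaceProd S C _ (weakTopology C), weakTopology C]
    fun p : S × C => T p.1 p.2

/-- `{T_s}` is equicontinuous on `(C, wk)`, for the weak uniformity of `H`. -/
def IsWeaklyEquicontinuous {C : Set H} (T : S → C → C) : Prop :=
  ∀ x : C, ∀ V ∈ 𝓝 (0 : WeakSpace ℂ H), ∃ U ∈ @nhds C (weakTopology C) x, ∀ x' ∈ U, ∀ s : S,
    toWeakSpace ℂ H (T s x' : H) - toWeakSpace ℂ H (T s x : H) ∈ V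

/-- The closure of `{T_s}` in the product space `C ^ C`, with `C` in its weak topology, consists of
weakly continuous maps. -/
def IsWeaklyQuasiEquicontinuous {C : Set H} (T : S → C → C) : Prop :=
  ∀ R ∈ @closure (C → C) (@Pi.topologicalSpace C (fun _ => C) fun _ => weakTopology C) (range T),
    Continuous[weakTopology C, weakTopology C] R

/-- The set `A_C(𝒮)` of attractive points. -/
def attractivePoints {C : Set H} (T : S → C → C) : Set H :=
  {a | ∀ (s : S) (x : C), ‖a - (T s x : H)‖ ≤ ‖a - (x : H)‖}

/-- `a = T_μ x`: for every `φ ∈ H*` the function `s ↦ φ (T_s x)` belongs to `X`, and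
`φ a = μ (s ↦ φ (T_s x))`. -/
def IsMeanPoint {C : Set H} (T : S → C → C) (X : Submodule ℂ (S →ᵇ ℂ)) (μ : X →L[ℂ] ℂ)
    (x : C) (a : H) : Prop :=
  ∀ φ : H →L[ℂ] ℂ, ∃ g : X, (∀ s : S, (g : S →ᵇ ℂ) s = φ (T s x : H)) ∧ φ a = μ g

theorem IsMeanPoint.unique {C : Set H} {T : S → C → C} {X : Submodule ℂ (S →ᵇ ℂ)}
    {μ : X →L[ℂ] ℂ} {x : C} {a b : H} (ha : IsMeanPoint T X μ x a) (hb : IsMeanPoint T X μ x b) :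
    a = b := by
  refine (SeparatingDual.eq_iff_forall_dual_eq (R := ℂ)).2 fun φ => ?_
  obtain ⟨g, hg, h1⟩ := ha φ
  obtain ⟨g', hg', h2⟩ := hb φ
  have : g = g' := Subtype.ext (DFunLike.ext _ _ fun s => (hg s).trans (hg' s).symm)
  exact h1.trans (this ▸ h2.symm)

/-- The point `T_μ x` (a junk value if there is no point satisfying `IsMeanPoint`). -/
def meanPoint {C : Set H} (T : S → C → C) (X : Submodule ℂ (S →ᵇ ℂ)) (μ : X →L[ℂ] ℂ)
    (x : C) : H :=
  Classical.epsilon (IsMeanPoint T X μ x)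

/-- The metric projection `P_D x`: the point of `D` nearest to `x`. -/
def metricProj (D : Set H) (x : H) : H :=
  Classical.epsilon fun u => u ∈ D ∧ ∀ z ∈ D, ‖x - u‖ ≤ ‖x - z‖

theorem metricProj_spec [CompleteSpace H] {D : Set H} (hne : D.Nonempty) (hcl : IsClosed D)
    (hconv : Convex ℝ D) (x : H) :
    metricProj D x ∈ D ∧ ∀ z ∈ D, ‖x - metricProj D x‖ ≤ ‖x - z‖ := by
  let _ : InnerProductSpace ℝ H := InnerProductSpace.rclikeToReal ℂ H
  obtain ⟨u, hu, h⟩ := exists_norm_eq_iInf_of_complete_convex hne hcl.isComplete hconv x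
  refine Classical.epsilon_spec (p := fun u => u ∈ D ∧ ∀ z ∈ D, ‖x - u‖ ≤ ‖x - z‖)
    ⟨u, hu, fun z hz => ?_⟩
  rw [h]
  exact ciInf_le ⟨0, by rintro _ ⟨w, rfl⟩; exact norm_nonneg _⟩ (⟨z, hz⟩ : D)

end Action

end

/-! Averaging a bounded orbit weakly against `μ` gives a point a = T_μ x, by Riesz representation.
Averaging ‖T_{st}x − T_s y‖² ≤ ‖T_t x − y‖² over t and using left invariance yields ‖a − T_s y‖ ≤ ‖a
− y‖, so a is attractive (`IsMeanPoint.mem_attractivePoints`); the projection of a onto a convex C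
is then a common fixed point. Distances from T_t x to attractive points decrease along the order, so
the projections of T_t x onto the attractive set are Cauchy, and right invariance identifies their
limit as T_μ x (`reversibleTendsto_metricProj`).

It must also be shown that the orbit functions s ↦ φ(T_s x) lie in X (`orbitFunction_mem`). When C
is weakly closed, orbits have weakly compact closure K, and translating an orbit function amounts to
moving the function φ on K by T_s. Compactness then gives uniform continuity for LUC, Arzelà–Ascoli
gives AP, and Grothendieck's principle, that bounded pointwise compact families in C(K) are weakly
compact, gives WAP. That principle rests on a convexity argument of Simons, which plays the role of
dominated convergence.

For the LIM on AP(S), the pointwise closure of the left translations is a compact topological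
semigroup. The two reversibility conditions make its kernel a compact group, and Haar measure there
provides the mean (`exists_isLIM_AP`). -/

noncomputable section

/-! ### Means and the weak averages of orbits. -/

section MeanPoints

variable {S : Type*} [TopologicalSpace S]

/-- Subtracting a constant c ≥ 0 from g gives ‖g − c‖² ≤ ‖g‖² + c², because Re g ≥ 0. If r = Re μ(g)
were negative, (r − c)² would exceed this bound for large c. -/
theorem IsMean.re_nonneg {X : Submodule ℂ (S →ᵇ ℂ)} {μ : X →L[ℂ] ℂ} (hμ : IsMean X μ) (g : X)
    (hg : ∀ s, 0 ≤ ((g : S →ᵇ ℂ) s).re) : 0 ≤ (μ g).re := by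
  obtain ⟨hn, h1, hone⟩ := hμ
  by_contra! hlt
  set r := (μ g).re
  -- Chosen so that −2cr = ‖g‖²; the comparison then reduces to r² ≤ 0.
  set c : ℝ := ‖g‖ ^ 2 / (-2 * r)
  have hc : 0 ≤ c := by
    apply div_nonneg (by positivity); linarith
  have hcr : -2 * c * r = ‖g‖ ^ 2 := by
    have : c * (-2 * r) = ‖g‖ ^ 2 := div_mul_cancel₀ _ (by linarith)
    linarith
  clear_value c
  have hle : ‖g - (c : ℂ) • (⟨1, h1⟩ : X)‖ ^ 2 ≤ ‖g‖ ^ 2 + c ^ 2 := by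
    have hs : (0 : ℝ) ≤ ‖g‖ ^ 2 + c ^ 2 := by positivity
    rw [← Real.sq_sqrt hs]
    gcongr
    refine (BoundedContinuousFunction.norm_le (Real.sqrt_nonneg _)).2 fun s => ?_
    change ‖((g - (c : ℂ) • (⟨1, h1⟩ : X) : X) : S →ᵇ ℂ) s‖ ≤ _
    apply Real.le_sqrt_of_sq_le
    have h2 : ‖(g : S →ᵇ ℂ) s‖ ^ 2 ≤ ‖g‖ ^ 2 := by
      gcongr; exact (g : S →ᵇ ℂ).norm_coe_le_norm s
    rw [← Complex.normSq_eq_norm_sq, Complex.normSq_apply] at h2 ⊢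
    have e : ((g - (c : ℂ) • (⟨1, h1⟩ : X) : X) : S →ᵇ ℂ) s = (g : S →ᵇ ℂ) s - c := by
      change (g : S →ᵇ ℂ) s - c * 1 = _
      rw [mul_one]
    rw [e]
    simp only [Complex.sub_re, Complex.sub_im, Complex.ofReal_re, Complex.ofReal_im]
    nlinarith [mul_nonneg hc (hg s)]
  have h3 := μ.le_opNorm (g - (c : ℂ) • (⟨1, h1⟩ : X))
  rw [map_sub, map_smul, hone, hn, one_mul] at h3
  have h4 : |r - c| ≤ ‖μ g - (c : ℂ) • 1‖ := by
    simpa [r] using Complex.abs_re_le_norm (μ g - (c : ℂ) • 1)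
  have h5 : (r - c) ^ 2 ≤ ‖g‖ ^ 2 + c ^ 2 := by
    refine le_trans ?_ hle
    rw [← sq_abs]
    gcongr
    exact h4.trans h3
  nlinarith

theorem IsMean.re_mono {X : Submodule ℂ (S →ᵇ ℂ)} {μ : X →L[ℂ] ℂ} (hμ : IsMean X μ) (f g : X)
    (hfg : ∀ s, ((f : S →ᵇ ℂ) s).re ≤ ((g : S →ᵇ ℂ) s).re) : (μ f).re ≤ (μ g).re := by
  have := hμ.re_nonneg (g - f) fun s => by simpa using hfg s
  simpa using this

theorem IsMean.map_const {X : Submodule ℂ (S →ᵇ ℂ)} {μ : X →L[ℂ] ℂ} (hμ : IsMean X μ)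
    (c : ℂ) (g : X) (hg : ∀ s, (g : S →ᵇ ℂ) s = c) : μ g = c := by
  obtain ⟨hn, h1, hone⟩ := hμ
  have : g = c • (⟨1, h1⟩ : X) := by
    ext s; simp [hg]
  rw [this, map_smul, hone, smul_eq_mul, mul_one]

variable {H : Type*} [NormedAddCommGroup H] [InnerProductSpace ℂ H]
variable {C : Set H} {T : S → C → C} {X : Submodule ℂ (S →ᵇ ℂ)} {μ : X →L[ℂ] ℂ}

theorem exists_isMeanPoint [CompleteSpace H] (hμ : IsMean X μ) (x : C)
    (hb : ∃ N, ∀ s, ‖(T s x : H)‖ ≤ N)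
    (hmem : ∀ φ : H →L[ℂ] ℂ, ∃ g : X, ∀ s, (g : S →ᵇ ℂ) s = φ (T s x : H)) :
    ∃ a, IsMeanPoint T X μ x a := by
  choose g hg using hmem
  obtain ⟨N, hN⟩ := hb
  -- The inner product is conjugate linear in its first slot, so conjugation makes this functional
  -- linear in y.
  let B : H →ₗ[ℂ] ℂ :=
    { toFun := fun y => starRingEnd ℂ (μ (g (InnerProductSpace.toDual ℂ H y)))
      map_add' := fun y z => by
        rw [← map_add, ← map_add]
        congr 2
        ext s
        simp [hg]
      map_smul' := fun c y => by
        have : g (InnerProductSpace.toDual ℂ H (c • y)) =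
            (starRingEnd ℂ c) • g (InnerProductSpace.toDual ℂ H y) := by
          ext s
          simp [hg, inner_smul_left]
        rw [this, map_smul]
        simp }
  let B' : H →L[ℂ] ℂ := B.mkContinuous (max N 0) fun y => by
    change ‖starRingEnd ℂ (μ (g (InnerProductSpace.toDual ℂ H y)))‖ ≤ _
    rw [RCLike.norm_conj]
    refine (μ.le_opNorm _).trans ?_
    rw [hμ.1, one_mul]
    refine (BoundedContinuousFunction.norm_le (by positivity)).2 fun s => ?_
    change ‖(g (InnerProductSpace.toDual ℂ H y) : S →ᵇ ℂ) s‖ ≤ _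
    rw [hg, mul_comm]
    refine (ContinuousLinearMap.le_opNorm _ _).trans ?_
    rw [LinearIsometryEquiv.norm_map]
    gcongr
    exact (hN s).trans (le_max_left _ _)
  refine ⟨(InnerProductSpace.toDual ℂ H).symm B', fun φ => ⟨g φ, hg φ, ?_⟩⟩
  obtain ⟨y, rfl⟩ := (InnerProductSpace.toDual ℂ H).surjective φ
  rw [InnerProductSpace.toDual_apply_apply, ← inner_conj_symm,
    InnerProductSpace.toDual_symm_apply]
  exact Complex.conj_conj _

theorem IsMeanPoint.meanPoint {x : C} {a : H} (ha : IsMeanPoint T X μ x a) :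
    IsMeanPoint T X μ x (meanPoint T X μ x) :=
  Classical.epsilon_spec (p := IsMeanPoint T X μ x) ⟨a, ha⟩

/-- The function t ↦ ‖T_t x‖² need not belong to X, so its mean is replaced by the lower integral
`sSup A`. The function `k` collects the remaining terms of the nonexpansive inequality, which reads
‖T_{st}x‖² − Re k(t) ≤ ‖T_t x‖². -/
theorem IsMeanPoint.mem_attractivePoints [Semigroup S] [SeparatelyContinuousMul S] (hμ : IsLIM X μ)
    (hX : ∀ (s : S) (f : S →ᵇ ℂ), f ∈ X → leftTranslate s f ∈ X)
    (hrep : ∀ (s t : S) (x : C), T (s * t) x = T s (T t x))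
    (hnonexp : ∀ (s : S) (x y : C), ‖(T s x : H) - (T s y : H)‖ ≤ ‖(x : H) - (y : H)‖)
    {x : C} {a : H} (ha : IsMeanPoint T X μ x a) (hb : ∃ N, ∀ s, ‖(T s x : H)‖ ≤ N) :
    a ∈ attractivePoints T := by
  intro s y
  obtain ⟨hmean, hinv⟩ := hμ
  have h1 : (1 : S →ᵇ ℂ) ∈ X := hmean.2.1
  obtain ⟨g₁, hg₁, ha₁⟩ := ha (innerSL ℂ (T s y : H))
  obtain ⟨g₂, hg₂, ha₂⟩ := ha (innerSL ℂ (y : H))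
  let d : ℝ := ‖(y : H)‖ ^ 2 - ‖(T s y : H)‖ ^ 2
  let k : X := (2 : ℂ) • (⟨leftTranslate s g₁, hX s _ g₁.2⟩ : X) - (2 : ℂ) • g₂
    + (d : ℂ) • (⟨1, h1⟩ : X)
  have hk : (μ k).re = 2 * (inner ℂ (T s y : H) a).re - 2 * (inner ℂ (y : H) a).re + d := by
    have : μ k = 2 * inner ℂ (T s y : H) a - 2 * inner ℂ (y : H) a + d := by
      simp only [k, map_add, map_sub, map_smul, hinv, ← ha₁, ← ha₂,
        hmean.map_const 1 ⟨1, h1⟩ fun _ => rfl]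
      simp
    rw [this]
    simp
  let A : Set ℝ := {r | ∃ g : X, (∀ t, ((g : S →ᵇ ℂ) t).re ≤ ‖(T t x : H)‖ ^ 2) ∧ r = (μ g).re}
  have hne : A.Nonempty := ⟨_, 0, fun t => by simp, rfl⟩
  have hbdd : BddAbove A := by
    obtain ⟨N, hN⟩ := hb
    refine ⟨N ^ 2, ?_⟩
    rintro _ ⟨g, hg, rfl⟩
    have := hmean.re_mono g (((N ^ 2 : ℝ) : ℂ) • (⟨1, h1⟩ : X)) fun t => by
      refine (hg t).trans ?_
      have : ‖(T t x : H)‖ ^ 2 ≤ N ^ 2 := by gcongr; exact hN t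
      simpa [-Complex.ofReal_pow] using this
    rwa [map_smul, hmean.map_const 1 ⟨1, h1⟩ fun t => rfl, smul_eq_mul, mul_one,
      Complex.ofReal_re] at this
  -- If g is admissible for `A`, so is ℓ_s g − k. Left invariance keeps μ(g), so comparing suprema
  -- forces Re μ(k) ≥ 0, which is the attractivity inequality at y.
  have key : ∀ r ∈ A, r ≤ sSup A + (μ k).re := by
    rintro _ ⟨g, hg, rfl⟩
    rw [← sub_le_iff_le_add]
    refine le_csSup hbdd ⟨(⟨leftTranslate s g, hX s _ g.2⟩ : X) - k, fun t => ?_, ?_⟩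
    · have h3 := hg (s * t)
      have h4 := hnonexp s (T t x) y
      rw [hrep] at h3
      have h5 : ‖(T s (T t x) : H) - (T s y : H)‖ ^ 2 ≤ ‖(T t x : H) - (y : H)‖ ^ 2 := by gcongr
      rw [norm_sub_rev, norm_sub_rev (T t x : H), @norm_sub_sq ℂ, @norm_sub_sq ℂ] at h5
      simp only [k, d]
      simp [hg₁, hg₂, hrep]
      simp only [RCLike.re_to_complex] at h5
      norm_cast
      linarith
    · rw [map_sub, hinv, Complex.sub_re]
  have h6 : sSup A ≤ sSup A + (μ k).re := csSup_le hne key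
  have h7 : ‖a - (T s y : H)‖ ^ 2 ≤ ‖a - (y : H)‖ ^ 2 := by
    rw [norm_sub_rev, norm_sub_rev a, @norm_sub_sq ℂ, @norm_sub_sq ℂ]
    simp only [RCLike.re_to_complex]
    simp only [d] at hk
    linarith
  exact le_of_sq_le_sq h7 (norm_nonneg _)

end MeanPoints

/-! ### Geometry of the attractive set and metric projections. -/

section Attractive

variable {S : Type*} {H : Type*} [NormedAddCommGroup H] [InnerProductSpace ℂ H]
variable {C : Set H} {T : S → C → C}

theorem isClosed_attractivePoints {H : Type*} [NormedAddCommGroup H] {C : Set H} {T : S → C → C} :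
    IsClosed (attractivePoints T) := by
  simp only [attractivePoints, ofPred_forall]
  exact isClosed_iInter fun s => isClosed_iInter fun x => isClosed_le (by fun_prop) (by fun_prop)

/-- The quadratic terms in a cancel after squaring, leaving a closed half-space. -/
theorem convex_setOf_norm_sub_le (p q : H) : Convex ℝ {a : H | ‖a - p‖ ≤ ‖a - q‖} := by
  have : {a : H | ‖a - p‖ ≤ ‖a - q‖} =
      {a : H | (2 : ℝ) * (inner ℂ (q - p) a).re ≤ ‖q‖ ^ 2 - ‖p‖ ^ 2} := by
    ext a
    simp only [mem_ofPred_eq]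
    rw [← sq_le_sq₀ (norm_nonneg _) (norm_nonneg _), norm_sub_rev, norm_sub_rev a,
      @norm_sub_sq ℂ, @norm_sub_sq ℂ, inner_sub_left]
    simp only [RCLike.re_to_complex, Complex.sub_re]
    constructor <;> intro h <;> linarith
  rw [this]
  refine convex_halfSpace_le ⟨fun x y => ?_, fun c x => ?_⟩ _
  · rw [inner_add_right, Complex.add_re, mul_add]
  · rw [← Complex.coe_smul, inner_smul_right, Complex.re_ofReal_mul, smul_eq_mul]; ring

theorem convex_attractivePoints : Convex ℝ (attractivePoints T) := by
  simp only [attractivePoints, ofPred_forall]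
  exact convex_iInter fun s => convex_iInter fun x => convex_setOf_norm_sub_le _ _

theorem metricProj_inner_nonpos [CompleteSpace H] {D : Set H} (hne : D.Nonempty)
    (hcl : IsClosed D) (hconv : Convex ℝ D) (x : H) {z : H} (hz : z ∈ D) :
    (inner ℂ (z - metricProj D x) (x - metricProj D x)).re ≤ 0 := by
  obtain ⟨hp, hmin⟩ := metricProj_spec hne hcl hconv x
  set p := metricProj D x
  by_contra! hpos
  set r := (inner ℂ (z - p) (x - p)).re
  have key : ∀ t : ℝ, 0 < t → t ≤ 1 → 2 * r ≤ t * ‖z - p‖ ^ 2 := by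
    intro t ht ht1
    have hm : p + t • (z - p) ∈ D := hconv.add_smul_sub_mem hp hz ⟨ht.le, ht1⟩
    have h2 := hmin _ hm
    have h3 : ‖x - p‖ ^ 2 ≤ ‖x - (p + t • (z - p))‖ ^ 2 := by gcongr
    rw [← sub_sub, norm_sub_rev (x - p), @norm_sub_sq ℂ _ _ _ _ (t • (z - p)),
      ← Complex.coe_smul, inner_smul_left, norm_smul, Complex.conj_ofReal,
      RCLike.re_to_complex, Complex.re_ofReal_mul, Complex.norm_real, mul_pow, Real.norm_eq_abs,
      sq_abs] at h3
    have : t * (2 * r) ≤ t * (t * ‖z - p‖ ^ 2) := by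
      simp only [r]; linarith
    exact le_of_mul_le_mul_left this ht
  have hq : 0 < ‖z - p‖ ^ 2 + r := by positivity
  -- This t lies in (0, 1] and makes t‖z − p‖² ≤ r < 2r.
  have h4 := key (r / (‖z - p‖ ^ 2 + r)) (by positivity)
    ((div_le_one hq).2 (le_add_of_nonneg_left (by positivity)))
  have h5 : r / (‖z - p‖ ^ 2 + r) * ‖z - p‖ ^ 2 ≤ r := by
    rw [div_mul_eq_mul_div, div_le_iff₀ hq]
    nlinarith
  linarith

theorem norm_sub_sq_add_norm_sub_metricProj_sq_le [CompleteSpace H] {D : Set H}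
    (hne : D.Nonempty) (hcl : IsClosed D) (hconv : Convex ℝ D) (x : H) {z : H} (hz : z ∈ D) :
    ‖z - metricProj D x‖ ^ 2 + ‖x - metricProj D x‖ ^ 2 ≤ ‖x - z‖ ^ 2 := by
  have h := metricProj_inner_nonpos hne hcl hconv x hz
  have h2 : x - z = (x - metricProj D x) - (z - metricProj D x) := by abel
  rw [h2, norm_sub_rev (x - _), @norm_sub_sq ℂ _ _ _ _ (z - _)]
  simp only [RCLike.re_to_complex]
  linarith

/-- Let p be the point of C nearest to a. Then T_s p is in C and no farther from a than p, so
uniqueness of the nearest point gives T_s p = p. -/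
theorem exists_common_fixedPoint [CompleteSpace H] (hC : IsClosed C) (hconv : Convex ℝ C)
    (hne : C.Nonempty) {a : H} (ha : a ∈ attractivePoints T) : ∃ x : C, ∀ s, T s x = x := by
  have hp := (metricProj_spec hne hC hconv a).1
  refine ⟨⟨metricProj C a, hp⟩, fun s => Subtype.ext ?_⟩
  have h1 := norm_sub_sq_add_norm_sub_metricProj_sq_le hne hC hconv a (T s ⟨_, hp⟩).2
  have h2 := ha s ⟨_, hp⟩
  have h3 : ‖a - (T s ⟨_, hp⟩ : H)‖ ^ 2 ≤ ‖a - metricProj C a‖ ^ 2 := by gcongr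
  have h4 : ‖(T s ⟨_, hp⟩ : H) - metricProj C a‖ ^ 2 ≤ 0 := by linarith
  exact sub_eq_zero.1 (norm_eq_zero.1 (pow_eq_zero_iff two_ne_zero |>.1
    (le_antisymm h4 (by positivity))))

end Attractive

/-! ### Convergence of the projected orbit. -/

section Convergence

variable {S : Type*} [Semigroup S] [TopologicalSpace S]
variable {H : Type*} [NormedAddCommGroup H] [InnerProductSpace ℂ H]
variable {C : Set H} {T : S → C → C} {X : Submodule ℂ (S →ᵇ ℂ)} {μ : X →L[ℂ] ℂ}

theorem reversibleLE_mul_left [SeparatelyContinuousMul S] (s a : S) :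
    ReversibleLE a (s * a) := by
  refine union_subset ?_ ?_
  · refine (closure_mono ?_).trans subset_union_left
    rintro _ ⟨u, rfl⟩
    exact ⟨u * s, mul_assoc _ _ _⟩
  · exact singleton_subset_iff.2 (Or.inl (subset_closure ⟨s, rfl⟩))

/-- For b = ua this is attractivity of z at T_a x; continuity of the orbit extends it to the closure
of Sa. -/
theorem norm_sub_le_of_reversibleLE {H : Type*} [NormedAddCommGroup H] {C : Set H}
    {T : S → C → C} (hrep : ∀ (s t : S) (x : C), T (s * t) x = T s (T t x))
    {x : C} (hcont : Continuous fun s : S => T s x) {z : H} (hz : z ∈ attractivePoints T)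
    {a b : S} (hab : ReversibleLE a b) : ‖(T b x : H) - z‖ ≤ ‖(T a x : H) - z‖ := by
  have hb : b ∈ closure (range fun u : S => u * a) ∪ {a} := hab (Or.inr rfl)
  rcases hb with hb | hb
  · have hcl : IsClosed {b : S | ‖(T b x : H) - z‖ ≤ ‖(T a x : H) - z‖} :=
      isClosed_le (by fun_prop) continuous_const
    refine closure_minimal ?_ hcl hb
    rintro _ ⟨u, rfl⟩
    simp only [mem_ofPred_eq, hrep]
    rw [norm_sub_rev, norm_sub_rev _ z]
    exact hz u (T a x)
  · rw [mem_singleton_iff.1 hb]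

theorem reversibleTendsto_metricProj [CompleteSpace H] [SeparatelyContinuousMul S] [Nonempty S]
    (hμ : IsRIM X μ) (hrep : ∀ (s t : S) (x : C), T (s * t) x = T s (T t x))
    {x : C} (hcont : Continuous fun s : S => T s x)
    (hmem : ∀ (y : C) (φ : H →L[ℂ] ℂ), ∃ g : X, ∀ s, (g : S →ᵇ ℂ) s = φ (T s y : H))
    {w : H} (hw : IsMeanPoint T X μ x w) (hwA : w ∈ attractivePoints T)
    (hb : ∃ N, ∀ s, ‖(T s x : H)‖ ≤ N) :
    ReversibleTendsto (fun t : S => metricProj (attractivePoints T) (T t x : H)) w := by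
  set A := attractivePoints T with hA
  have hne : A.Nonempty := ⟨w, hwA⟩
  have hcl : IsClosed A := isClosed_attractivePoints
  have hcv : Convex ℝ A := convex_attractivePoints
  set P : S → H := fun t => metricProj A (T t x : H) with hP
  have hPA : ∀ t, P t ∈ A := fun t => (metricProj_spec hne hcl hcv _).1
  have hbA : BddBelow (range fun t => ‖(T t x : H) - P t‖ ^ 2) :=
    ⟨0, by rintro _ ⟨t, rfl⟩; positivity⟩
  set m := ⨅ t, ‖(T t x : H) - P t‖ ^ 2 with hm
  have hclose : ∀ ε : ℝ, 0 < ε → ∃ a, ∀ b, ReversibleLE a b → ‖P b - P a‖ ≤ ε := by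
    intro ε hε
    -- For b after a, the Pythagorean inequality bounds ‖P a − P b‖² by ‖T_a x − P a‖² − m, which is
    -- less than ε².
    obtain ⟨a, ha⟩ := exists_lt_of_ciInf_lt (show m < m + ε ^ 2 by simp [hε])
    refine ⟨a, fun b hab => ?_⟩
    have h1 := norm_sub_sq_add_norm_sub_metricProj_sq_le hne hcl hcv (T b x : H) (hPA a)
    have h2 := norm_sub_le_of_reversibleLE hrep hcont (hPA a) hab
    have h3 : ‖(T b x : H) - P a‖ ^ 2 ≤ ‖(T a x : H) - P a‖ ^ 2 := by gcongr
    have h4 : m ≤ ‖(T b x : H) - P b‖ ^ 2 := ciInf_le hbA b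
    rw [norm_sub_rev]
    refine le_of_sq_le_sq ?_ hε.le
    change ‖P a - P b‖ ^ 2 + ‖(T b x : H) - P b‖ ^ 2 ≤ _ at h1
    linarith
  obtain ⟨N, hN⟩ := hb
  have hdist : ∀ t, ‖(T t x : H) - P t‖ ≤ N + ‖w‖ := fun t =>
    ((metricProj_spec hne hcl hcv _).2 w hwA).trans ((norm_sub_le _ _).trans (by gcongr; exact hN t))
  have hdist' : ∀ t, ‖w - P t‖ ≤ 2 * (N + ‖w‖) := fun t => by
    have h1 : w - P t = ((T t x : H) - P t) - ((T t x : H) - w) := by abel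
    rw [h1]
    refine (norm_sub_le _ _).trans ?_
    have := (norm_sub_le (T t x : H) w).trans (add_le_add_left (hN t) _)
    linarith [hdist t]
  obtain ⟨s₀⟩ := ‹Nonempty S›
  have hN0 : 0 ≤ N := (norm_nonneg _).trans (hN s₀)
  -- The errors in `e2` and `e3` contribute N + ‖w‖ and 2(N + ‖w‖); the 1 ensures positivity.
  set K := 3 * (N + ‖w‖) + 1 with hK
  have hKpos : 0 < K := by positivity
  -- The angle at P(sa) between w and T_{sa}x is obtuse. Replacing P(sa) by P a costs at most εK,
  -- and averaging over s with right invariance turns T_{sa}x into w.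
  have hlim : ∀ ε : ℝ, 0 < ε → ∀ a, (∀ b, ReversibleLE a b → ‖P b - P a‖ ≤ ε) →
      ‖w - P a‖ ^ 2 ≤ ε * K := by
    intro ε hε a ha
    obtain ⟨g, hg, hgw⟩ := hw (innerSL ℂ (w - P a))
    obtain ⟨g', hg'⟩ := hmem (T a x) (innerSL ℂ (w - P a))
    have heq : rightTranslate a (g : S →ᵇ ℂ) = g' := by
      ext s; rw [rightTranslate_apply, hg, hg', hrep]
    have hr : μ g' = μ g := by
      rw [← hμ.2 a g (heq ▸ g'.2)]
      congr 1
      exact Subtype.ext heq.symm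
    have h1 : (1 : S →ᵇ ℂ) ∈ X := hμ.1.2.1
    have hle := hμ.1.re_mono g'
      (((ε * K : ℝ) + inner ℂ (w - P a) (P a)) • (⟨1, h1⟩ : X)) fun s => by
      have hp := metricProj_inner_nonpos hne hcl hcv (T (s * a) x : H) hwA
      change (inner ℂ (w - P (s * a)) ((T (s * a) x : H) - P (s * a))).re ≤ 0 at hp
      have hc := ha _ (reversibleLE_mul_left s a)
      have e1 : inner ℂ (w - P a) ((T (s * a) x : H) - P a) =
          inner ℂ (w - P (s * a)) ((T (s * a) x : H) - P (s * a)) +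
          inner ℂ (P (s * a) - P a) ((T (s * a) x : H) - P (s * a)) +
          inner ℂ (w - P a) (P (s * a) - P a) := by
        rw [← inner_add_left, sub_add_sub_cancel, ← inner_add_right, sub_add_sub_cancel]
      have e2 : (inner ℂ (P (s * a) - P a) ((T (s * a) x : H) - P (s * a))).re ≤
          ε * (N + ‖w‖) :=
        (Complex.re_le_norm _).trans ((norm_inner_le_norm _ _).trans
          (mul_le_mul hc (hdist _) (norm_nonneg _) hε.le))
      have e3 : (inner ℂ (w - P a) (P (s * a) - P a)).re ≤ 2 * (N + ‖w‖) * ε :=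
        (Complex.re_le_norm _).trans ((norm_inner_le_norm _ _).trans
          (mul_le_mul (hdist' _) hc (norm_nonneg _) (by positivity)))
      have e4 : (inner ℂ (w - P a) (T (s * a) x : H)).re =
          (inner ℂ (w - P a) ((T (s * a) x : H) - P a)).re + (inner ℂ (w - P a) (P a)).re := by
        rw [← Complex.add_re, ← inner_add_right, sub_add_cancel]
      rw [hg', ← hrep]
      simp only [innerSL_apply_apply]
      rw [e4, e1]
      have e7 : (((((ε * K : ℝ) : ℂ) + inner ℂ (w - P a) (P a)) • (⟨1, h1⟩ : X) : X) :
          S →ᵇ ℂ) s = ((ε * K : ℝ) : ℂ) + inner ℂ (w - P a) (P a) := by simp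
      rw [e7]
      simp only [Complex.add_re, Complex.ofReal_re, hK]
      nlinarith
    rw [hr, ← hgw, map_smul, hμ.1.map_const 1 _ fun s => rfl, smul_eq_mul, mul_one,
      Complex.add_re, Complex.ofReal_re, innerSL_apply_apply] at hle
    have e5 : ((‖w - P a‖ ^ 2 : ℝ) : ℂ) = inner ℂ (w - P a) w - inner ℂ (w - P a) (P a) := by
      rw [← inner_sub_right, inner_self_eq_norm_sq_to_K]; simp
    have e6 := congrArg Complex.re e5
    rw [Complex.ofReal_re, Complex.sub_re] at e6
    linarith
  intro U hU
  obtain ⟨δ, hδ, hball⟩ := Metric.mem_nhds_iff.1 hU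
  set ε := min (δ / 3) ((δ / 3) ^ 2 / K) with hε
  have hεpos : 0 < ε := by positivity
  obtain ⟨a, ha⟩ := hclose ε hεpos
  refine ⟨a, fun b hab => hball ?_⟩
  have h1 : ‖w - P a‖ ≤ δ / 3 := by
    refine le_of_sq_le_sq ((hlim ε hεpos a ha).trans ?_) (by positivity)
    rw [← le_div_iff₀ hKpos]
    exact min_le_right _ _
  have h2 : ‖P b - P a‖ ≤ δ / 3 := (ha b hab).trans (min_le_left _ _)
  rw [Metric.mem_ball, dist_eq_norm]
  have h3 : metricProj A (T b x : H) - w = (P b - P a) - (w - P a) := by simp [hP]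
  rw [h3]
  refine (norm_sub_le _ _).trans_lt ?_
  linarith

end Convergence

/-! ### Orbit functions in LUC and AP. -/

section Membership

variable {S : Type*} [Semigroup S] [TopologicalSpace S] [SeparatelyContinuousMul S]
variable {Y : Type*} [TopologicalSpace Y] {T : S → Y → Y} {ψ : Y → ℂ} {y : Y}

/-- By compactness of the orbit closure, joint continuity makes ψ(T_s k) close to ψ(T_{s₀} k)
uniformly in k; k = T_t y gives the translates of f. -/
theorem mem_LUC_of_continuous (hT : Continuous fun p : S × Y => T p.1 p.2) (hψ : Continuous ψ)
    (hK : IsCompact (closure (range fun t => T t y)))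
    (hrep : ∀ s t, T (s * t) y = T s (T t y)) (f : S →ᵇ ℂ) (hf : ∀ s, f s = ψ (T s y)) :
    f ∈ LUC S := by
  change Continuous fun s : S => leftTranslate s f
  refine continuous_iff_continuousAt.2 fun s₀ => Metric.tendsto_nhds.2 fun ε hε => ?_
  have h : ∀ᶠ s in 𝓝 s₀, ∀ k ∈ closure (range fun t => T t y),
      dist (ψ (T s k)) (ψ (T s₀ k)) < ε / 2 := by
    refine hK.eventually_forall_of_forall_eventually fun k _ => ?_
    have hc : Continuous fun p : S × Y => dist (ψ (T p.1 p.2)) (ψ (T s₀ p.2)) := by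
      refine (hψ.comp hT).dist (hψ.comp (hT.comp (continuous_const.prodMk continuous_snd)))
    have := hc.continuousAt (x := (s₀, k))
    exact this.eventually (gt_mem_nhds (by simpa using half_pos hε))
  filter_upwards [h] with s hs
  refine lt_of_le_of_lt ((BoundedContinuousFunction.dist_le (half_pos hε).le).2 fun t => ?_)
    (half_lt_self hε)
  rw [leftTranslate_apply, leftTranslate_apply, hf, hf, hrep, hrep]
  exact (hs _ (subset_closure ⟨t, rfl⟩)).le

/-- Arzelà–Ascoli applies to the functions k ↦ ψ(T_s k) on the orbit closure; composition with t ↦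
T_t y carries them onto the left translates of f. -/
theorem mem_AP_of_equicontinuous
    (hT : ∀ z, ∀ ε > 0, ∀ᶠ z' in 𝓝 z, ∀ s, dist (ψ (T s z')) (ψ (T s z)) < ε)
    (ho : Continuous fun t => T t y) (hK : IsCompact (closure (range fun t => T t y)))
    (hrep : ∀ s t, T (s * t) y = T s (T t y)) (f : S →ᵇ ℂ) (hf : ∀ s, f s = ψ (T s y)) :
    f ∈ AP S := by
  set K := closure (range fun t => T t y)
  have hc : ∀ s, Continuous fun z => ψ (T s z) := fun s =>
    continuous_iff_continuousAt.2 fun z => Metric.tendsto_nhds.2 fun ε hε =>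
      (hT z ε hε).mono fun z' h => h s
  have : CompactSpace K := isCompact_iff_compactSpace.1 hK
  let g : S → K →ᵇ ℂ := fun s =>
    BoundedContinuousFunction.mkOfCompact ⟨fun k => ψ (T s k), (hc s).comp continuous_subtype_val⟩
  let o : C(S, K) := ⟨fun t => ⟨T t y, subset_closure ⟨t, rfl⟩⟩, by fun_prop⟩
  have hA : IsCompact (closure (range g)) := by
    refine BoundedContinuousFunction.arzela_ascoli (Metric.closedBall 0 ‖f‖)
      (isCompact_closedBall _ _) _ ?_ ?_
    · rintro _ ⟨k, hk⟩ ⟨s, rfl⟩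
      have hcl : IsClosed {z | ψ (T s z) ∈ Metric.closedBall (0 : ℂ) ‖f‖} :=
        Metric.isClosed_closedBall.preimage (hc s)
      refine closure_minimal ?_ hcl hk
      rintro _ ⟨t, rfl⟩
      simp only [mem_ofPred_eq, mem_closedBall_zero_iff, ← hrep, ← hf]
      exact f.norm_coe_le_norm _
    · intro k
      rw [Metric.equicontinuousAt_iff_right]
      intro ε hε
      have h2 := continuous_subtype_val.continuousAt.eventually (hT k ε hε)
      filter_upwards [h2] with k' hk'
      rintro ⟨_, s, rfl⟩
      rw [dist_comm]
      exact hk' s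
  refine (hA.image (BoundedContinuousFunction.compContinuousCLM ℂ ℂ o).continuous).closure_of_subset ?_
  rintro _ ⟨s, rfl⟩
  refine ⟨g s, subset_closure ⟨s, rfl⟩, ?_⟩
  ext t
  rw [leftTranslate_apply, hf, hrep]
  rfl

end Membership

/-! ### Weak compactness in Hilbert space. -/

section WeakCompactness

variable {H : Type*} [NormedAddCommGroup H] [InnerProductSpace ℂ H]

/-- Banach–Alaoglu transported by the inverse Riesz map, which is weak-* to weak continuous. -/
theorem isCompact_toWeakSpace_image_closedBall [CompleteSpace H] (N : ℝ) :
    IsCompact (toWeakSpace ℂ H '' Metric.closedBall 0 N) := by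
  let e : WeakDual ℂ H → WeakSpace ℂ H := fun ℓ =>
    toWeakSpace ℂ H ((InnerProductSpace.toDual ℂ H).symm (WeakDual.toStrongDual ℓ))
  have he : Continuous e := by
    refine WeakBilin.continuous_of_continuous_eval _ fun φ => ?_
    obtain ⟨y, rfl⟩ := (InnerProductSpace.toDual ℂ H).surjective φ
    have : Continuous fun ℓ : WeakDual ℂ H => starRingEnd ℂ (ℓ y) :=
      Complex.continuous_conj.comp (WeakDual.eval_continuous y)
    convert this using 2 with ℓ
    change inner ℂ y ((InnerProductSpace.toDual ℂ H).symm (WeakDual.toStrongDual ℓ)) = _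
    rw [← inner_conj_symm, InnerProductSpace.toDual_symm_apply]
    rfl
  convert (WeakDual.isCompact_closedBall (0 : StrongDual ℂ H) N).image he using 1
  symm
  ext v
  constructor
  · rintro ⟨ℓ, hℓ, rfl⟩
    refine ⟨_, ?_, rfl⟩
    simpa using hℓ
  · rintro ⟨x, hx, rfl⟩
    refine ⟨StrongDual.toWeakDual (InnerProductSpace.toDual ℂ H x), ?_, ?_⟩
    · simpa using hx
    · simp [e]

theorem isCompact_weak_closure_of_bounded [CompleteSpace H] {C : Set H} (hC : IsWeaklyClosed C)
    (A : Set C) {N : ℝ} (hN : ∀ x ∈ A, ‖(x : H)‖ ≤ N) :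
    @IsCompact C (weakTopology C) (@closure C (weakTopology C) A) := by
  let _ : TopologicalSpace C := weakTopology C
  have hi : IsInducing fun x : C => toWeakSpace ℂ H (x : H) := ⟨rfl⟩
  have : T2Space C := T2Space.of_injective_continuous
    ((toWeakSpace ℂ H).injective.comp Subtype.val_injective) hi.continuous
  have hcpt : IsCompact {x : C | ‖(x : H)‖ ≤ N} := by
    rw [hi.isCompact_iff]
    convert (isCompact_toWeakSpace_image_closedBall (H := H) N).inter_right hC using 1
    symm
    ext v
    constructor
    · rintro ⟨⟨x, hx, rfl⟩, z, hz, hzx⟩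
      obtain rfl := (toWeakSpace ℂ H).injective hzx
      exact ⟨⟨z, hz⟩, by simpa using hx, rfl⟩
    · rintro ⟨x, hx, rfl⟩
      exact ⟨⟨x, by simpa using hx, rfl⟩, x, x.2, rfl⟩
  exact hcpt.closure_of_subset hN

theorem continuous_weakTopology_apply {C : Set H} (φ : H →L[ℂ] ℂ) :
    Continuous[weakTopology C, _] fun x : C => φ (x : H) := by
  let _ : TopologicalSpace C := weakTopology C
  have h1 : Continuous fun v : WeakSpace ℂ H => φ ((toWeakSpace ℂ H).symm v) :=
    WeakBilin.eval_continuous (B := (topDualPairing ℂ H).flip) φ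
  exact h1.comp continuous_induced_dom

theorem continuous_weakTopology_of_continuous {A : Type*} [TopologicalSpace A] {C : Set H}
    {f : A → C} (hf : Continuous f) : Continuous[_, weakTopology C] f :=
  continuous_induced_rng.2
    ((toWeakSpaceCLM ℂ H).continuous.comp (continuous_subtype_val.comp hf))

end WeakCompactness

/-! ### Simons' convexity argument. -/

section Simons

variable {E : Type*} [NormedAddCommGroup E] [NormedSpace ℝ E]

/-- `B` is a norming set on which norms are attained. If the hull stayed at distance δ from 0,
nearly minimal choices `Y` from the tail hulls `D n` would give w = Σ 2^{-(k+1)} y_k, and the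
functional attaining ‖w‖ would stay above δ/2 on points of every tail hull, contrary to pointwise
convergence. -/
theorem exists_mem_closedConvexHull_norm_lt [CompleteSpace E] (B : Set (E →L[ℝ] ℝ))
    (hB₁ : ∀ β ∈ B, ∀ z, β z ≤ ‖z‖) (hB₂ : ∀ z, ∃ β ∈ B, β z = ‖z‖) (g : ℕ → E) {M : ℝ}
    (hM : ∀ n, ‖g n‖ ≤ M) (hg : ∀ β ∈ B, Tendsto (fun n => β (g n)) atTop (𝓝 0))
    {δ : ℝ} (hδ : 0 < δ) : ∃ y ∈ closedConvexHull ℝ (range g), ‖y‖ < δ := by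
  by_contra! hfar
  let D : ℕ → Set E := fun n => closedConvexHull ℝ (g '' Ici n)
  have hDconv : ∀ n, Convex ℝ (D n) := fun n => convex_closedConvexHull
  have hDcl : ∀ n, IsClosed (D n) := fun n => isClosed_closedConvexHull
  have hDg : ∀ n, g n ∈ D n := fun n => subset_closedConvexHull ⟨n, self_mem_Ici, rfl⟩
  have hDmono : ∀ n j, D (n + j) ⊆ D n := fun n j =>
    (closedConvexHull ℝ).monotone (image_mono (Ici_subset_Ici.2 (Nat.le_add_right _ _)))
  have hDsub : ∀ n, D n ⊆ closedConvexHull ℝ (range g) := fun n =>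
    (closedConvexHull ℝ).monotone (image_subset_range _ _)
  have hDM : ∀ n, ∀ v ∈ D n, ‖v‖ ≤ M := by
    intro n v hv
    have : D n ⊆ Metric.closedBall 0 M := by
      refine closedConvexHull_min ?_ (convex_closedBall _ _) Metric.isClosed_closedBall
      rintro _ ⟨k, _, rfl⟩
      simpa using hM k
    simpa using this hv
  have hstep : ∀ (n : ℕ) (z : E), ∃ y ∈ D n, ∀ y' ∈ D n,
      ‖z + (1 / 2 : ℝ) ^ n • y‖ ≤ ‖z + (1 / 2 : ℝ) ^ n • y'‖ + δ / 4 * (1 / 4 : ℝ) ^ n := by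
    intro n z
    have : Nonempty (D n) := ⟨⟨_, hDg n⟩⟩
    have hbd : BddBelow (range fun y : D n => ‖z + (1 / 2 : ℝ) ^ n • (y : E)‖) :=
      ⟨0, by rintro _ ⟨y, rfl⟩; positivity⟩
    have hpos : 0 < δ / 4 * (1 / 4 : ℝ) ^ n := by positivity
    obtain ⟨y, hy⟩ := exists_lt_of_ciInf_lt (lt_add_of_pos_right
      (⨅ y : D n, ‖z + (1 / 2 : ℝ) ^ n • (y : E)‖) hpos)
    refine ⟨y, y.2, fun y' hy' => hy.le.trans ?_⟩
    gcongr
    exact ciInf_le hbd ⟨y', hy'⟩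
  choose Y hYD hYmin using hstep
  let z : ℕ → E := fun n => Nat.rec 0 (fun n z => z + (1 / 2 : ℝ) ^ (n + 1) • Y n z) n
  have hz : ∀ n, z (n + 1) = z n + (1 / 2 : ℝ) ^ (n + 1) • Y n (z n) := fun n => rfl
  have hz0 : z 0 = 0 := rfl
  clear_value z
  obtain ⟨w, hw⟩ : ∃ w, Tendsto z atTop (𝓝 w) := by
    refine cauchySeq_tendsto_of_complete (cauchySeq_of_le_geometric (1 / 2) (M / 2) (by norm_num)
      fun n => ?_)
    rw [dist_eq_norm, hz, sub_add_cancel_left, norm_neg, norm_smul, norm_pow]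
    have := hDM _ _ (hYD n (z n))
    norm_num
    rw [pow_succ]
    have h2 : (0 : ℝ) < (1 / 2) ^ n := by positivity
    nlinarith
  -- The first j weights 1/2, …, 2^{-j} leave a remainder 2^{-j}, which is put on v to form a convex
  -- combination.
  have hind : ∀ n j, ∀ v ∈ D n, (2 : ℝ) ^ n • (z (n + j) - z n) + (1 / 2 : ℝ) ^ j • v ∈ D n := by
    intro n j
    induction j with
    | zero => intro v hv; simpa using hv
    | succ j ih =>
      intro v hv
      have hmid := hDconv n (hDmono n j (hYD (n + j) (z (n + j)))) hv
        (show (0 : ℝ) ≤ 1 / 2 by norm_num) (show (0 : ℝ) ≤ 1 / 2 by norm_num) (by norm_num)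
      convert ih _ hmid using 1
      rw [← add_assoc, hz, add_sub_right_comm, smul_add, smul_add, smul_smul, smul_smul, smul_smul,
        add_assoc]
      have e1 : (2 : ℝ) ^ n * (1 / 2) ^ (n + j + 1) = (1 / 2) ^ j * (1 / 2) := by
        rw [add_assoc, pow_add, ← mul_assoc, ← mul_pow]; norm_num [pow_succ]
      rw [e1, pow_succ]
  have hwD : ∀ n, (2 : ℝ) ^ n • (w - z n) ∈ D n := by
    intro n
    refine (hDcl n).mem_of_tendsto (b := atTop) (f := fun j => (2 : ℝ) ^ n • (z (n + j) - z n) +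
      (1 / 2 : ℝ) ^ j • g n) ?_ (Eventually.of_forall fun j => hind n j _ (hDg n))
    have h1 : Tendsto (fun j => z (n + j)) atTop (𝓝 w) := by
      simpa only [add_comm n] using (tendsto_add_atTop_iff_nat n).2 hw
    have h2 : Tendsto (fun j : ℕ => (1 / 2 : ℝ) ^ j) atTop (𝓝 0) :=
      tendsto_pow_atTop_nhds_zero_of_lt_one (by norm_num) (by norm_num)
    simpa using ((h1.sub_const (z n)).const_smul ((2 : ℝ) ^ n)).add (h2.smul_const (g n))
  obtain ⟨β, hβ, hβw⟩ := hB₂ w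
  -- Testing near-minimality of y_n against 2^n(w − z_n) compares ‖2z_{n+1} − z_n‖ with ‖w‖ = β w.
  -- Each step thus loses at most (δ/4)2^{-n}, in total less than δ/2.
  have hlow : ∀ n : ℕ, δ / 2 + δ / 2 * (1 / 2 : ℝ) ^ n ≤ β ((2 : ℝ) ^ n • (w - z n)) := by
    intro n
    induction n with
    | zero =>
      have := hfar _ (hDsub 0 (hwD 0))
      simp only [hz0, pow_zero, one_smul, sub_zero, mul_one] at this ⊢
      linarith
    | succ n ih =>
      have h1 := hYmin n (z n) _ (hwD n)
      have e0 : (1 / 2 : ℝ) ^ n * 2 ^ n = 1 := by rw [← mul_pow]; norm_num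
      rw [smul_smul, e0, one_smul, add_sub_cancel] at h1
      have h2 := (hB₁ β hβ _).trans h1
      have e1 : (1 / 2 : ℝ) ^ n • Y n (z n) = (2 : ℝ) • (z (n + 1) - z n) := by
        rw [hz, add_sub_cancel_left, smul_smul, pow_succ]
        congr 1; ring
      rw [e1, ← hβw] at h2
      simp only [map_add, map_smul, map_sub, smul_eq_mul] at h2 ih ⊢
      have e2 : (1 / 4 : ℝ) ^ n = (1 / 2) ^ n * (1 / 2) ^ n := by rw [← mul_pow]; norm_num
      have h3 := mul_le_mul_of_nonneg_left h2 (show (0 : ℝ) ≤ 2 ^ n by positivity)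
      have e3 : (2 : ℝ) ^ n * (β w + δ / 4 * (1 / 4) ^ n) =
          2 ^ n * β w + δ / 4 * (1 / 2) ^ n := by
        rw [e2]; linear_combination (δ / 4 * (1 / 2 : ℝ) ^ n) * e0
      rw [e3] at h3
      rw [pow_succ, pow_succ]
      linarith
  obtain ⟨n, hn⟩ := eventually_atTop.1 ((hg β hβ).eventually (gt_mem_nhds
    (show (0 : ℝ) < δ / 2 by positivity)))
  have hD : D n ⊆ {v | β v ≤ δ / 2} := by
    refine closedConvexHull_min ?_ (convex_halfSpace_le β.toLinearMap.isLinear _)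
      (isClosed_le β.continuous continuous_const)
    rintro _ ⟨k, hk, rfl⟩
    exact (hn k hk).le
  have h1 : β ((2 : ℝ) ^ n • (w - z n)) ≤ δ / 2 := hD (hwD n)
  have h2 := hlow n
  have h3 : 0 < δ / 2 * (1 / 2 : ℝ) ^ n := by positivity
  linarith

end Simons

/-! ### From pointwise to weak continuity in C(K). -/

section PointwiseCompactness

variable {K : Type*} [TopologicalSpace K] [CompactSpace K] [Nonempty K]

/-- The rotated evaluations f ↦ Re(θ f(k)), |θ| = 1, attain every norm because K is compact. Were u
≥ ε on all g_n, it would be so on their closed convex hull, which contains elements of arbitrarily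
small norm. -/
theorem exists_apply_lt_of_tendsto_pointwise (g : ℕ → K →ᵇ ℂ) {M : ℝ} (hM : ∀ n, ‖g n‖ ≤ M)
    (hg : ∀ k, Tendsto (fun n => g n k) atTop (𝓝 0)) (u : (K →ᵇ ℂ) →L[ℝ] ℝ) {ε : ℝ}
    (hε : 0 < ε) : ∃ n, u (g n) < ε := by
  let b : ℂ → K → (K →ᵇ ℂ) →L[ℝ] ℝ := fun θ k =>
    Complex.reCLM.comp ((θ • BoundedContinuousFunction.evalCLM ℂ k).restrictScalars ℝ)
  have hb : ∀ θ k f, b θ k f = (θ * f k).re := fun _ _ _ => rfl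
  by_contra! hge
  obtain ⟨y, hy, hyn⟩ := exists_mem_closedConvexHull_norm_lt {β | ∃ θ k, ‖θ‖ = 1 ∧ β = b θ k}
    (by
      rintro _ ⟨θ, k, hθ, rfl⟩ f
      rw [hb]
      refine (Complex.re_le_norm _).trans ?_
      rw [norm_mul, hθ, one_mul]
      exact f.norm_coe_le_norm k)
    (by
      intro f
      obtain ⟨k, -, hk⟩ := isCompact_univ.exists_isMaxOn (univ_nonempty (α := K))
        (f := fun k => ‖f k‖) (by fun_prop)
      obtain ⟨θ, hθ, hθf⟩ := RCLike.exists_norm_eq_mul_self (f k)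
      refine ⟨b θ k, ⟨θ, k, hθ, rfl⟩, ?_⟩
      rw [hb, ← hθf]
      exact le_antisymm (f.norm_coe_le_norm k)
        ((BoundedContinuousFunction.norm_le (norm_nonneg _)).2 fun k' => hk (mem_univ k')))
    g hM
    (by
      rintro _ ⟨θ, k, hθ, rfl⟩
      simp only [hb]
      have := ((hg k).const_mul θ)
      rw [mul_zero] at this
      exact (Complex.continuous_re.tendsto 0).comp this)
    (δ := ε / (‖u‖ + 1)) (by positivity)
  have hsub : closedConvexHull ℝ (range g) ⊆ {v | ε ≤ u v} := by
    refine closedConvexHull_min ?_ (convex_halfSpace_ge u.toLinearMap.isLinear _)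
      (isClosed_le continuous_const u.continuous)
    rintro _ ⟨k, rfl⟩
    exact hge k
  have h1 : ε ≤ u y := hsub hy
  have h2 : u y ≤ ‖u‖ * ‖y‖ := (le_abs_self _).trans (u.le_opNorm y)
  rw [lt_div_iff₀ (by positivity)] at hyn
  nlinarith [norm_nonneg u, norm_nonneg y]

variable {E : Type*} [TopologicalSpace E] [CompactSpace E]

theorem exists_finset_approx {K E : Type*} [TopologicalSpace K] [CompactSpace K]
    (G : E → K →ᵇ ℂ) (F : Finset E) {η : ℝ} (hη : 0 < η) :
    ∃ D : Finset K, ∀ k, ∃ d ∈ D, ∀ Q ∈ F, ‖G Q k - G Q d‖ < η := by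
  obtain ⟨D, -, hD⟩ := isCompact_univ.elim_nhds_subcover
    (fun d => {k | ∀ Q ∈ F, ‖G Q k - G Q d‖ < η}) fun d _ => by
      refine (eventually_all_finset F).2 fun Q _ => ?_
      have hc : Continuous fun k => ‖G Q k - G Q d‖ := by fun_prop
      exact hc.continuousAt.eventually (gt_mem_nhds (by simpa using hη))
  refine ⟨D, fun k => ?_⟩
  obtain ⟨d, hd, hk⟩ := mem_iUnion₂.1 (hD (mem_univ k))
  exact ⟨d, hd, hk⟩

/-- If the estimate failed near R₀, a sequence of bad parameters could be chosen whose functions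
converge pointwise to G R₀, contradicting `exists_apply_lt_of_tendsto_pointwise`. -/
theorem eventually_apply_lt_of_continuous_pointwise (G : E → K →ᵇ ℂ)
    (hG : ∀ k, Continuous fun R => G R k) {M : ℝ} (hM : ∀ R, ‖G R‖ ≤ M)
    (u : (K →ᵇ ℂ) →L[ℝ] ℝ) (R₀ : E) {ε : ℝ} (hε : 0 < ε) :
    ∀ᶠ R in 𝓝 R₀, u (G R) < u (G R₀) + ε := by
  classical
  by_contra hnot
  have hfreq : ∃ᶠ R in 𝓝 R₀, u (G R₀) + ε ≤ u (G R) := by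
    simpa only [not_lt] using not_eventually.1 hnot
  have hpos : ∀ n : ℕ, (0 : ℝ) < 1 / (n + 1) := fun n => by positivity
  -- The set D approximates every point of K as seen by the parameters already chosen; the new R is
  -- bad for u but agrees with R₀ on D up to 1/(n+1).
  have hstep : ∀ (p : Finset E × Finset K) (n : ℕ), ∃ (R : E) (D : Finset K), p.2 ⊆ D ∧
      (∀ k, ∃ d ∈ D, ∀ Q ∈ p.1, ‖G Q k - G Q d‖ < 1 / (n + 1)) ∧
      u (G R₀) + ε ≤ u (G R) ∧ ∀ d ∈ D, ‖G R d - G R₀ d‖ < 1 / (n + 1) := by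
    intro p n
    obtain ⟨D, hD⟩ := exists_finset_approx G p.1 (hpos n)
    have hnear : ∀ᶠ R in 𝓝 R₀, ∀ d ∈ p.2 ∪ D, ‖G R d - G R₀ d‖ < 1 / (n + 1) := by
      refine (eventually_all_finset _).2 fun d _ => ?_
      have hc : Continuous fun R => ‖G R d - G R₀ d‖ := ((hG d).sub continuous_const).norm
      exact hc.continuousAt.eventually (gt_mem_nhds (by simpa using hpos n))
    obtain ⟨R, hR, hRd⟩ := (hfreq.and_eventually hnear).exists
    refine ⟨R, p.2 ∪ D, Finset.subset_union_left, fun k => ?_, hR, hRd⟩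
    obtain ⟨d, hd, h⟩ := hD k
    exact ⟨d, Finset.mem_union_right _ hd, h⟩
  choose R D hDsub hDapp hRu hRd using hstep
  let σ : ℕ → Finset E × Finset K := fun n =>
    Nat.rec ({R₀}, ∅) (fun n p => (insert (R p n) p.1, D p n)) n
  have hσ : ∀ n, σ (n + 1) = (insert (R (σ n) n) (σ n).1, D (σ n) n) := fun n => rfl
  have hσ0 : (σ 0).1 = {R₀} := rfl
  clear_value σ
  have hmono₁ : Monotone fun n => (σ n).1 :=
    monotone_nat_of_le_succ fun n => by
      rw [hσ]; exact Finset.subset_insert _ _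
  have hmono₂ : Monotone fun n => (σ n).2 :=
    monotone_nat_of_le_succ fun n => by
      rw [hσ]; exact hDsub _ _
  let r : ℕ → E := fun n => R (σ n) n
  have hr : ∀ i n, i < n → r i ∈ (σ n).1 := fun i n hin =>

    hmono₁ (Nat.succ_le_of_lt hin) (by
      change r i ∈ (σ (i + 1)).1
      rw [hσ]
      exact Finset.mem_insert_self _ _)
  have hr0 : ∀ n, R₀ ∈ (σ n).1 := fun n => hmono₁ (Nat.zero_le n) (by simp [hσ0])
  have hlim0 : Tendsto (fun n : ℕ => (1 : ℝ) / (n + 1)) atTop (𝓝 0) :=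
    tendsto_one_div_add_atTop_nhds_zero_nat
  -- Along an ultrafilter let r_n → Q, and let net points d_n approximating k tend to l. Earlier
  -- parameters, R₀ and hence Q cannot distinguish k from l, while G Q and G R₀ agree at every d_j
  -- and so at l.
  have hpt : ∀ k, Tendsto (fun n => G (r n) k) atTop (𝓝 (G R₀ k)) := by
    intro k
    rw [tendsto_iff_ultrafilter]
    intro U hU
    choose d hd hdk using fun n => hDapp (σ n) n k
    obtain ⟨Q, -, hQ⟩ := isCompact_univ.ultrafilter_le_nhds (U.map r) (by simp)
    obtain ⟨l, -, hl⟩ := isCompact_univ.ultrafilter_le_nhds (U.map d) (by simp)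
    have hQ' : Tendsto r U (𝓝 Q) := hQ
    have hl' : Tendsto d U (𝓝 l) := hl
    have hGr : ∀ j, Tendsto (fun n => G (r n) j) U (𝓝 (G Q j)) := fun j =>
      ((hG j).tendsto Q).comp hQ'
    have hGd : ∀ P, Tendsto (fun n => G P (d n)) U (𝓝 (G P l)) := fun P =>
      ((G P).continuous.tendsto l).comp hl'
    have hsame : ∀ P, (∀ᶠ n in atTop, P ∈ (σ n).1) → G P k = G P l := by
      intro P hP
      refine tendsto_nhds_unique (f := fun n => G P (d n)) (l := (U : Filter ℕ)) ?_ (hGd P)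
      rw [tendsto_iff_norm_sub_tendsto_zero]
      refine squeeze_zero' (Eventually.of_forall fun n => norm_nonneg _) ?_ (hlim0.mono_left hU)
      filter_upwards [hU hP] with n hn
      rw [norm_sub_rev]
      exact (hdk n P hn).le
    have h0 : G R₀ k = G R₀ l := hsame R₀ (Eventually.of_forall hr0)
    have hQk : G Q k = G Q l := by
      refine tendsto_nhds_unique (hGr k) ((hGr l).congr fun i => ?_)
      exact (hsame (r i) ((eventually_gt_atTop i).mono fun n => hr i n)).symm
    have hQd : ∀ j, G Q (d j) = G R₀ (d j) := by
      intro j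
      refine tendsto_nhds_unique (hGr (d j)) ?_
      rw [tendsto_iff_norm_sub_tendsto_zero]
      refine squeeze_zero' (Eventually.of_forall fun n => norm_nonneg _) ?_ (hlim0.mono_left hU)
      refine hU ((eventually_ge_atTop j).mono fun n hn => (hRd (σ n) n (d j) ?_).le)
      have h1 : (σ (j + 1)).2 ⊆ (σ (n + 1)).2 := hmono₂ (Nat.succ_le_succ hn)
      rw [hσ, hσ] at h1
      exact h1 (hd j)
    have hQl : G Q l = G R₀ l := by
      refine tendsto_nhds_unique (hGd Q) ?_
      simpa only [hQd] using hGd R₀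
    rw [h0, ← hQl, ← hQk]
    exact hGr k
  obtain ⟨n, hn⟩ := exists_apply_lt_of_tendsto_pointwise (fun n => G (r n) - G R₀) (M := M + M)
    (fun n => (norm_sub_le _ _).trans (add_le_add (hM _) (hM _)))
    (fun k => by simpa using (hpt k).sub_const (G R₀ k)) u hε
  have := hRu (σ n) n
  rw [map_sub] at hn
  change _ ≤ u (G (r n)) at this
  linarith

/-- A bounded family of continuous functions on a compact space that depends continuously on a
compact parameter in the pointwise topology does so in the weak topology. -/
theorem continuous_dual_apply_of_continuous_pointwise (G : E → K →ᵇ ℂ)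
    (hG : ∀ k, Continuous fun R => G R k) {M : ℝ} (hM : ∀ R, ‖G R‖ ≤ M)
    (m : (K →ᵇ ℂ) →L[ℂ] ℂ) : Continuous fun R => m (G R) := by
  have hreal : ∀ u : (K →ᵇ ℂ) →L[ℝ] ℝ, Continuous fun R => u (G R) := by
    intro u
    refine continuous_iff_continuousAt.2 fun R₀ => Metric.tendsto_nhds.2 fun ε hε => ?_
    filter_upwards [eventually_apply_lt_of_continuous_pointwise G hG hM u R₀ hε,
      eventually_apply_lt_of_continuous_pointwise G hG hM (-u) R₀ hε] with R h1 h2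
    simp only [neg_apply] at h2
    rw [Real.dist_eq, abs_lt]
    constructor <;> linarith
  have h := (Complex.continuous_ofReal.comp
    (hreal (Complex.reCLM.comp (m.restrictScalars ℝ)))).add
    ((Complex.continuous_ofReal.comp
      (hreal (Complex.imCLM.comp (m.restrictScalars ℝ)))).mul (continuous_const (y := Complex.I)))
  refine h.congr fun R => ?_
  exact Complex.re_add_im _

end PointwiseCompactness

/-! ### Orbit functions in WAP. -/

section WAP

variable {S : Type*} [Semigroup S] [TopologicalSpace S] [SeparatelyContinuousMul S]
variable {Y : Type*} [TopologicalSpace Y] {T : S → Y → Y} {ψ : Y → ℂ} {y : Y}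

/-- The closure of {T_s} is compact by Tychonoff and its members map K into K. R ↦ ψ ∘ R on K is
pointwise continuous and bounded, hence weakly continuous, so its weakly compact image pulls back to
a set containing all translates of f. -/
theorem mem_WAP_of_quasiEquicontinuous (hT : ∀ R ∈ closure (range T), Continuous R)
    (hψ : Continuous ψ) (ho : Continuous fun t => T t y)
    (hK : ∀ z, IsCompact (closure (range fun t => T t z)))
    (hrep : ∀ s t, T (s * t) y = T s (T t y)) (f : S →ᵇ ℂ) (hf : ∀ s, f s = ψ (T s y)) :
    f ∈ WAP S := by
  rcases isEmpty_or_nonempty S with hS | ⟨⟨s₀⟩⟩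
  · change IsCompact (closure (range fun s : S => toWeakSpace ℂ (S →ᵇ ℂ) (leftTranslate s f)))
    rw [range_eq_empty, closure_empty]
    exact isCompact_empty
  set K := closure (range fun t => T t y)
  have : CompactSpace K := isCompact_iff_compactSpace.1 (hK y)
  have hE : IsCompact (closure (range T)) := by
    refine (isCompact_univ_pi hK).of_isClosed_subset isClosed_closure
      (closure_minimal ?_ (isClosed_set_pi fun _ _ => isClosed_closure))
    rintro _ ⟨s, rfl⟩ z -
    exact subset_closure ⟨s, rfl⟩
  have : CompactSpace (closure (range T)) := isCompact_iff_compactSpace.1 hE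
  let o : C(S, K) := ⟨fun t => ⟨T t y, subset_closure ⟨t, rfl⟩⟩, by fun_prop⟩
  have : Nonempty K := ⟨o s₀⟩
  have hmaps : ∀ R ∈ closure (range T), ∀ k ∈ K, R k ∈ K := by
    intro R hR k hk
    have h1 : MapsTo R (range fun t => T t y) K := by
      rintro _ ⟨t, rfl⟩
      have hcl : IsClosed {R : Y → Y | R (T t y) ∈ K} :=
        isClosed_closure.preimage (continuous_apply (T t y))
      refine closure_minimal ?_ hcl hR
      rintro _ ⟨s, rfl⟩
      exact subset_closure ⟨s * t, hrep s t⟩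
    exact closure_minimal h1 (isClosed_closure.preimage (hT R hR)) hk
  obtain ⟨M, hM⟩ := (hK y).exists_bound_of_continuousOn hψ.continuousOn
  let G : closure (range T) → K →ᵇ ℂ := fun R => BoundedContinuousFunction.mkOfCompact
    ⟨fun k => ψ (R.1 k), hψ.comp ((hT _ R.2).comp continuous_subtype_val)⟩
  have hG : ∀ k, Continuous fun R => G R k := fun k =>
    hψ.comp ((continuous_apply (k : Y)).comp continuous_subtype_val)
  have hGM : ∀ R, ‖G R‖ ≤ M := fun R =>
    (BoundedContinuousFunction.norm_le ((norm_nonneg _).trans (hM _ (o s₀).2))).2 fun k =>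
      hM _ (hmaps _ R.2 _ k.2)
  let Φ : closure (range T) → WeakSpace ℂ (S →ᵇ ℂ) := fun R =>
    toWeakSpace ℂ (S →ᵇ ℂ) (BoundedContinuousFunction.compContinuousCLM ℂ ℂ o (G R))
  have hΦ : Continuous Φ := WeakBilin.continuous_of_continuous_eval _ fun m =>
    continuous_dual_apply_of_continuous_pointwise G hG hGM
      (m.comp (BoundedContinuousFunction.compContinuousCLM ℂ ℂ o))
  refine (isCompact_range hΦ).closure_of_subset ?_
  rintro _ ⟨s, rfl⟩
  refine ⟨⟨T s, subset_closure ⟨s, rfl⟩⟩, ?_⟩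
  refine congrArg (toWeakSpace ℂ (S →ᵇ ℂ)) ?_
  ext t
  rw [leftTranslate_apply, hf, hrep]
  rfl

end WAP

/-! ### Kernels of compact semigroups and Haar measure. -/

section CompactSemigroup

theorem exists_forall_mem_range_of_reversible {M : Type*} [TopologicalSpace M] [CompactSpace M]
    [T2Space M] [Nonempty M] {f : M → M → M} (hf : ∀ a, Continuous (f a))
    (hassoc : ∀ a b c, f (f a b) c = f a (f b c)) (hrev : ∀ a b, ∃ x y, f a x = f b y) :
    ∃ k, ∀ a, ∃ x, f a x = k := by
  have hne : (⋂ a, range (f a)).Nonempty := by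
    refine IsCompact.nonempty_iInter_of_directed_nonempty_isCompact_isClosed _ ?_
      (fun a => range_nonempty _) (fun a => isCompact_range (hf a))
      fun a => (isCompact_range (hf a)).isClosed
    intro a b
    obtain ⟨x, y, hxy⟩ := hrev a b
    refine ⟨f a x, ?_, ?_⟩
    · rintro _ ⟨z, rfl⟩
      exact ⟨f x z, (hassoc _ _ _).symm⟩
    · rintro _ ⟨z, rfl⟩
      exact ⟨f y z, by rw [hxy, hassoc]⟩
  obtain ⟨k, hk⟩ := hne
  exact ⟨k, fun a => mem_iInter.1 hk a⟩

/-- The condition on (a, b) is closed, being a projection along a compact factor, so it suffices to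
check it on the dense image. Keeping `o` and `f` abstract covers multiplication and its opposite. -/
theorem DenseRange.exists_eq_of_reversible {S M : Type*} [TopologicalSpace S] [TopologicalSpace M]
    [CompactSpace M] [T2Space M] {π : S → M} (hd : DenseRange π) (hπ : Continuous π)
    {o : S → S → S} {f : M → M → M} (hf : Continuous (Function.uncurry f))
    (hhom : ∀ s t, π (o s t) = f (π s) (π t))
    (hrev : ∀ s t, (closure (range (o s)) ∩ closure (range (o t))).Nonempty) (a b : M) :
    ∃ x y, f a x = f b y := by
  refine hd.induction_on₂ (p := fun a b => ∃ x y, f a x = f b y) ?_ ?_ a b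
  · have hcl : IsClosed {q : (M × M) × (M × M) | f q.1.1 q.2.1 = f q.1.2 q.2.2} :=
      isClosed_eq (hf.comp (by fun_prop : Continuous fun q : (M × M) × (M × M) => (q.1.1, q.2.1)))
        (hf.comp (by fun_prop : Continuous fun q : (M × M) × (M × M) => (q.1.2, q.2.2)))
    convert isClosedMap_fst_of_compactSpace _ hcl using 1
    ext q
    constructor
    · rintro ⟨x, y, h⟩
      exact ⟨(q, (x, y)), h, rfl⟩
    · rintro ⟨⟨_, x, y⟩, h, rfl⟩
      exact ⟨x, y, h⟩
  · intro s t
    obtain ⟨u, hu, hv⟩ := hrev s t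
    have key : ∀ s, u ∈ closure (range (o s)) → ∃ x, f (π s) x = π u := by
      intro s hu
      have hc : Continuous (f (π s)) := hf.comp (Continuous.prodMk_right (π s))
      have hcl : IsClosed (π ⁻¹' range (f (π s))) :=
        (isCompact_range hc).isClosed.preimage hπ
      refine closure_minimal ?_ hcl hu
      rintro _ ⟨t, rfl⟩
      exact ⟨π t, (hhom s t).symm⟩
    obtain ⟨x, hx⟩ := key s hu
    obtain ⟨y, hy⟩ := key t hv
    exact ⟨x, y, hx.trans hy.symm⟩

/-- Any ultrafilter limit b of inverses satisfies ab = 1. -/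
theorem continuous_inv_of_compactSpace {G : Type*} [Group G] [TopologicalSpace G] [CompactSpace G]
    [T2Space G] [ContinuousMul G] : Continuous fun g : G => g⁻¹ := by
  refine continuous_iff_ultrafilter.2 fun a U hU => ?_
  obtain ⟨b, -, hb⟩ := isCompact_univ.ultrafilter_le_nhds (U.map fun g : G => g⁻¹) (by simp)
  have hb' : Tendsto (fun g : G => g⁻¹) U (𝓝 b) := hb
  have h1 : Tendsto (fun g : G => g * g⁻¹) U (𝓝 (a * b)) := Tendsto.mul hU hb'
  simp only [mul_inv_cancel] at h1
  rw [inv_eq_of_mul_eq_one_right (tendsto_nhds_unique h1 tendsto_const_nhds)]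
  exact hb'

variable {M : Type*} [Semigroup M] [TopologicalSpace M] [CompactSpace M] [T2Space M]
  [ContinuousMul M]

/-- The kernel of a compact semigroup in which any two principal right ideals meet and any two
principal left ideals meet is a compact group. -/
theorem exists_group_ideal [Nonempty M] (hl : ∀ a b : M, ∃ x y, a * x = b * y)
    (hr : ∀ a b : M, ∃ x y, x * a = y * b) :
    ∃ K : Set M, IsClosed K ∧ ∃ e ∈ K, (∀ k ∈ K, e * k = k) ∧ (∀ k ∈ K, k * e = k) ∧
      (∀ s, ∀ k ∈ K, s * k ∈ K) ∧ ∀ k ∈ K, ∃ g ∈ K, g * k = e := by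
  let K : Set M := {k | (∀ a, k ∈ range fun x => a * x) ∧ ∀ a, k ∈ range fun x => x * a}
  have hKcl : IsClosed K := by
    have h1 : IsClosed {k : M | ∀ a, k ∈ range fun x => a * x} := by
      rw [show {k : M | ∀ a, k ∈ range fun x => a * x} = ⋂ a, range fun x => a * x by
        ext; simp]
      exact isClosed_iInter fun a => (isCompact_range (continuous_const_mul a)).isClosed
    have h2 : IsClosed {k : M | ∀ a, k ∈ range fun x => x * a} := by
      rw [show {k : M | ∀ a, k ∈ range fun x => x * a} = ⋂ a, range fun x => x * a by
        ext; simp]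
      exact isClosed_iInter fun a => (isCompact_range (continuous_mul_const a)).isClosed
    exact h1.inter h2
  have hright : ∀ i j : M, (∀ a, i ∈ range fun x => a * x) → ∀ a, i * j ∈ range fun x => a * x := by
    intro i j hi a
    obtain ⟨x, rfl⟩ := hi a
    exact ⟨x * j, (mul_assoc _ _ _).symm⟩
  have hleft : ∀ i j : M, (∀ a, j ∈ range fun x => x * a) → ∀ a, i * j ∈ range fun x => x * a := by
    intro i j hj a
    obtain ⟨x, rfl⟩ := hj a
    exact ⟨i * x, mul_assoc _ _ _⟩
  obtain ⟨i, hi⟩ := exists_forall_mem_range_of_reversible (f := fun a b : M => a * b)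
    continuous_const_mul mul_assoc hl
  obtain ⟨j, hj⟩ := exists_forall_mem_range_of_reversible (f := fun a b : M => b * a)
    continuous_mul_const (fun a b c => (mul_assoc c b a).symm) hr
  have hmem : i * j ∈ K := ⟨hright i j hi, hleft i j hj⟩
  obtain ⟨e, he, hee⟩ := exists_idempotent_in_compact_subsemigroup continuous_mul_const K
    ⟨_, hmem⟩ hKcl.isCompact fun x hx y hy => ⟨hright x y hx.1, hleft x y hy.2⟩
  have hel : ∀ k ∈ K, e * k = k := by
    intro k hk
    obtain ⟨x, rfl⟩ := hk.1 e
    simp only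
    rw [← mul_assoc, hee]
  have her : ∀ k ∈ K, k * e = k := by
    intro k hk
    obtain ⟨x, rfl⟩ := hk.2 e
    simp only
    rw [mul_assoc, hee]
  have hmid : ∀ x, e * x * e ∈ K := fun x =>
    ⟨hright _ _ (hright _ _ he.1), hleft _ _ he.2⟩
  have hlinv : ∀ k ∈ K, ∃ g ∈ K, g * k = e := by
    intro k hk
    obtain ⟨x, hx⟩ := he.2 k
    refine ⟨_, hmid x, ?_⟩
    rw [mul_assoc, hel k hk, mul_assoc]
    rw [show x * k = e from hx, hee]
  have hrinv : ∀ k ∈ K, ∃ g ∈ K, k * g = e := by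
    intro k hk
    obtain ⟨x, hx⟩ := he.1 k
    refine ⟨_, hmid x, ?_⟩
    rw [← mul_assoc, ← mul_assoc, her k hk, show k * x = e from hx, hee]
  refine ⟨K, hKcl, e, he, hel, her, ?_, hlinv⟩
  intro s k hk
  -- With g = exe in K one has (sk)g = e; if h in K is a right inverse of g, then sk = (sk)gh = h
  -- lies in K.
  obtain ⟨x, hx⟩ := he.1 (s * k)
  have hye : s * k * e = s * k := by rw [mul_assoc, her k hk]
  have hyg : s * k * (e * x * e) = e := by
    rw [← mul_assoc, ← mul_assoc, hye, show s * k * x = e from hx, hee]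
  obtain ⟨h, hh, hgh⟩ := hrinv _ (hmid x)
  rw [← hye, ← hgh, ← mul_assoc, hyg, hel h hh]
  exact hh

/-- A compact semigroup in which any two principal right ideals meet and any two principal left
ideals meet has a left invariant mean on its continuous functions. -/
theorem exists_invariant_functional [Nonempty M] (hl : ∀ a b : M, ∃ x y, a * x = b * y)
    (hr : ∀ a b : M, ∃ x y, x * a = y * b) :
    ∃ Λ : C(M, ℂ) →ₗ[ℂ] ℂ, (∀ f, ‖Λ f‖ ≤ ‖f‖) ∧ Λ 1 = 1 ∧
      ∀ (s : M) (f g : C(M, ℂ)), (∀ x, g x = f (s * x)) → Λ g = Λ f := by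
  obtain ⟨K, hKcl, e, he, hel, her, hideal, hinv⟩ := exists_group_ideal hl hr
  choose inv hinvK hinv_mul using hinv
  let _ : Group K :=
    { mul := fun a b => ⟨a.1 * b.1, hideal _ _ b.2⟩
      mul_assoc := fun a b c => Subtype.ext (mul_assoc _ _ _)
      one := ⟨e, he⟩
      one_mul := fun a => Subtype.ext (hel _ a.2)
      mul_one := fun a => Subtype.ext (her _ a.2)
      inv := fun a => ⟨inv a.1 a.2, hinvK _ _⟩
      inv_mul_cancel := fun a => Subtype.ext (hinv_mul _ _) }
  have hmul : ∀ a b : K, ((a * b : K) : M) = a.1 * b.1 := fun _ _ => rfl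
  have : CompactSpace K := isCompact_iff_compactSpace.1 hKcl.isCompact
  have : ContinuousMul K := ⟨by
    refine Continuous.subtype_mk (f := fun p : K × K => p.1.1 * p.2.1) ?_ _
    fun_prop⟩
  have : ContinuousInv K := ⟨continuous_inv_of_compactSpace⟩
  have : IsTopologicalGroup K := {}
  let _ : MeasurableSpace K := borel K
  have : BorelSpace K := ⟨rfl⟩
  let ν : MeasureTheory.Measure K := MeasureTheory.Measure.haarMeasure ⊤
  have hν : ν univ = 1 := MeasureTheory.Measure.haarMeasure_self (K₀ := ⊤)
  have : MeasureTheory.IsProbabilityMeasure ν := ⟨hν⟩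
  have hint : ∀ f : C(M, ℂ), MeasureTheory.Integrable (fun k : K => f k) ν := fun f =>
    Continuous.integrable_of_hasCompactSupport (by fun_prop)
      (HasCompactSupport.of_compactSpace _)
  let Λ : C(M, ℂ) →ₗ[ℂ] ℂ :=
    { toFun := fun f => ∫ k : K, f k ∂ν
      map_add' := fun f g => MeasureTheory.integral_add (hint f) (hint g)
      map_smul' := fun c f => MeasureTheory.integral_smul c _ }
  have hΛ : ∀ f, Λ f = ∫ k : K, f k ∂ν := fun _ => rfl
  refine ⟨Λ, fun f => ?_, ?_, fun s f g hg => ?_⟩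
  · rw [hΛ]
    refine (MeasureTheory.norm_integral_le_of_norm_le_const (C := ‖f‖)
      (Eventually.of_forall fun k => f.norm_coe_le_norm _)).trans ?_
    simp
  · rw [hΛ]
    simp
  -- On K, multiplication by s is multiplication by the group element se, since sk = (se)k.
  · rw [hΛ, hΛ, ← MeasureTheory.integral_mul_left_eq_self (fun k : K => f k)
      (⟨s * e, hideal s e he⟩ : K)]
    refine MeasureTheory.integral_congr_ae (Eventually.of_forall fun k => ?_)
    simp only [hg, hmul]
    rw [mul_assoc, hel k k.2]

end CompactSemigroup

/-! ### The compact semigroup of translations on AP(S). -/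

section AlmostPeriodic

variable {S : Type*} [Semigroup S] [TopologicalSpace S] [SeparatelyContinuousMul S]

/-- Left translation as a map of `AP(S)` into itself. -/
def leftTranslateAP (s : S) (f : AP S) : AP S := ⟨leftTranslate s f, leftTranslate_mem_AP s f.2⟩

theorem lipschitzWith_leftTranslateAP (s : S) : LipschitzWith 1 (leftTranslateAP s) := by
  refine LipschitzWith.of_dist_le_mul fun f g => ?_
  rw [NNReal.coe_one, one_mul]
  change dist (leftTranslate s (f : S →ᵇ ℂ)) (leftTranslate s (g : S →ᵇ ℂ)) ≤
    dist (f : S →ᵇ ℂ) (g : S →ᵇ ℂ)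
  exact (BoundedContinuousFunction.dist_le dist_nonneg).2 fun t =>
    BoundedContinuousFunction.dist_coe_le_dist (f := (f : S →ᵇ ℂ)) (g := g) (s * t)

theorem leftTranslate_mem_closure {f g : S →ᵇ ℂ} (t : S)
    (hg : g ∈ closure (range fun s => leftTranslate s f)) :
    leftTranslate t g ∈ closure (range fun s => leftTranslate s f) := by
  have hc : Continuous fun g : S →ᵇ ℂ => leftTranslate t g :=
    (BoundedContinuousFunction.compContinuousCLM ℂ ℂ _).continuous
  refine map_mem_closure hc hg ?_
  rintro _ ⟨s, rfl⟩
  exact ⟨s * t, (leftTranslate_leftTranslate _ _ _).symm⟩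

theorem isCompact_closure_leftTranslateAP (f : AP S) :
    IsCompact (closure (range fun s => leftTranslateAP s f)) := by
  have hO : IsCompact {g : AP S | (g : S →ᵇ ℂ) ∈
      closure (range fun s => leftTranslate s (f : S →ᵇ ℂ))} := by
    rw [IsInducing.subtypeVal.isCompact_iff]
    convert (show IsCompact (closure (range fun s => leftTranslate s (f : S →ᵇ ℂ))) from f.2)
      using 1
    ext g
    constructor
    · rintro ⟨g, hg, rfl⟩
      exact hg
    · intro hg
      refine ⟨⟨g, ?_⟩, hg, rfl⟩
      refine IsCompact.closure_of_subset
        (show IsCompact (closure (range fun s => leftTranslate s (f : S →ᵇ ℂ))) from f.2) ?_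
      rintro _ ⟨t, rfl⟩
      exact leftTranslate_mem_closure t hg
  refine hO.closure_of_subset ?_
  rintro _ ⟨s, rfl⟩
  exact subset_closure ⟨s, rfl⟩

/-- On the norm compact orbit closure the norm topology equals that of pointwise convergence, for
which continuity in s is separate continuity of the product. -/
theorem continuous_leftTranslateAP (f : AP S) : Continuous fun s => leftTranslateAP s f := by
  set O := closure (range fun s => leftTranslateAP s f)
  have : CompactSpace O := isCompact_iff_compactSpace.1 (isCompact_closure_leftTranslateAP f)
  let ι : O → S → ℂ := fun g t => (g : AP S).1 t
  have hι : IsClosedEmbedding ι := by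
    refine Continuous.isClosedEmbedding ?_ ?_
    · refine continuous_pi fun t => ?_
      exact (continuous_eval_const (F := S →ᵇ ℂ) t).comp
        (continuous_subtype_val.comp continuous_subtype_val)
    · intro g h hgh
      exact Subtype.ext (Subtype.ext (DFunLike.coe_injective hgh))
  have hc : Continuous fun s : S => (⟨leftTranslateAP s f, subset_closure ⟨s, rfl⟩⟩ : O) := by
    rw [hι.isInducing.continuous_iff]
    refine continuous_pi fun t => ?_
    exact (f : S →ᵇ ℂ).continuous.comp (SeparatelyContinuousMul.continuous_mul_const (a := t))
  exact continuous_subtype_val.comp hc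

variable (S) in
/-- The closure of the left translations in the topology of pointwise convergence on `AP(S)`. -/
def translationHull : Set (AP S → AP S) := closure (range leftTranslateAP)

theorem isCompact_translationHull : IsCompact (translationHull S) := by
  refine (isCompact_univ_pi isCompact_closure_leftTranslateAP).of_isClosed_subset isClosed_closure
    (closure_minimal ?_ (isClosed_set_pi fun _ _ => isClosed_closure))
  rintro _ ⟨s, rfl⟩ f -
  exact subset_closure ⟨s, rfl⟩

theorem lipschitzWith_of_mem_translationHull {R : AP S → AP S} (hR : R ∈ translationHull S) :
    LipschitzWith 1 R := by
  refine LipschitzWith.of_dist_le_mul fun f g => ?_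
  have hcl : IsClosed {R : AP S → AP S | dist (R f) (R g) ≤ ((1 : NNReal) : ℝ) * dist f g} :=
    isClosed_le ((continuous_apply f).dist (continuous_apply g)) continuous_const
  refine closure_minimal ?_ hcl hR
  rintro _ ⟨s, rfl⟩
  exact (lipschitzWith_leftTranslateAP s).dist_le_mul f g

theorem map_add_of_mem_translationHull {R : AP S → AP S} (hR : R ∈ translationHull S)
    (f g : AP S) : R (f + g) = R f + R g := by
  have hcl : IsClosed {R : AP S → AP S | R (f + g) = R f + R g} :=
    isClosed_eq (continuous_apply _) ((continuous_apply f).add (continuous_apply g))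
  refine closure_minimal ?_ hcl hR
  rintro _ ⟨s, rfl⟩
  rfl

theorem map_smul_of_mem_translationHull {R : AP S → AP S} (hR : R ∈ translationHull S)
    (c : ℂ) (f : AP S) : R (c • f) = c • R f := by
  have hcl : IsClosed {R : AP S → AP S | R (c • f) = c • R f} :=
    isClosed_eq (continuous_apply _) ((continuous_apply f).const_smul c)
  refine closure_minimal ?_ hcl hR
  rintro _ ⟨s, rfl⟩
  rfl

theorem map_one_of_mem_translationHull {R : AP S → AP S} (hR : R ∈ translationHull S) :
    R ⟨1, one_mem_AP⟩ = ⟨1, one_mem_AP⟩ := by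
  have hcl : IsClosed {R : AP S → AP S | R ⟨1, one_mem_AP⟩ = ⟨1, one_mem_AP⟩} :=
    isClosed_eq (continuous_apply _) continuous_const
  refine closure_minimal ?_ hcl hR
  rintro _ ⟨s, rfl⟩
  rfl

theorem comp_mem_translationHull {R R' : AP S → AP S} (hR : R ∈ translationHull S)
    (hR' : R' ∈ translationHull S) : R' ∘ R ∈ translationHull S := by
  have h1 : ∀ s : S, leftTranslateAP s ∘ R ∈ translationHull S := by
    intro s
    have hc : Continuous fun R : AP S → AP S => leftTranslateAP s ∘ R :=
      continuous_pi fun f =>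
        (lipschitzWith_leftTranslateAP s).continuous.comp (continuous_apply f)
    refine map_mem_closure hc hR ?_
    rintro _ ⟨t, rfl⟩
    refine ⟨t * s, ?_⟩
    ext f
    exact congrFun (congrArg _ (leftTranslate_leftTranslate s t (f : S →ᵇ ℂ)).symm) _
  have hc : Continuous fun R' : AP S → AP S => R' ∘ R :=
    continuous_pi fun f => continuous_apply (R f)
  refine closure_minimal ?_ (isClosed_closure.preimage hc) hR'
  rintro _ ⟨s, rfl⟩
  exact h1 s

/-- The order of composition is reversed because ℓ_{st} = ℓ_t ∘ ℓ_s. -/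
instance : Semigroup (translationHull S) where
  mul R R' := ⟨R'.1 ∘ R.1, comp_mem_translationHull R.2 R'.2⟩
  mul_assoc _ _ _ := rfl

instance : CompactSpace (translationHull S) :=
  isCompact_iff_compactSpace.1 isCompact_translationHull

/-- Joint continuity comes from the members of the hull being uniformly 1-Lipschitz. -/
instance : ContinuousMul (translationHull S) where
  continuous_mul := by
    refine Continuous.subtype_mk (f := fun p : translationHull S × translationHull S =>
      p.2.1 ∘ p.1.1) (continuous_pi fun f => ?_) _
    have h : Continuous fun q : AP S × translationHull S => q.2.1 q.1 :=
      continuous_prod_of_continuous_lipschitzWith _ 1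
        (fun g => (continuous_apply g).comp continuous_subtype_val)
        fun R => lipschitzWith_of_mem_translationHull R.2
    have h2 : Continuous fun p : translationHull S × translationHull S => (p.1.1 f, p.2) :=
      (((continuous_apply f).comp continuous_subtype_val).comp continuous_fst).prodMk
        continuous_snd
    exact h.comp h2

/-- The canonical homomorphism from `S` to its translation hull. -/
def toTranslationHull (s : S) : translationHull S := ⟨leftTranslateAP s, subset_closure ⟨s, rfl⟩⟩

theorem toTranslationHull_mul (s t : S) :
    toTranslationHull (s * t) = toTranslationHull s * toTranslationHull t := by
  refine Subtype.ext (funext fun f => Subtype.ext ?_)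
  exact (leftTranslate_leftTranslate t s (f : S →ᵇ ℂ)).symm

theorem continuous_toTranslationHull : Continuous (toTranslationHull : S → translationHull S) :=
  Continuous.subtype_mk (continuous_pi fun f => continuous_leftTranslateAP f) _

theorem denseRange_toTranslationHull : DenseRange (toTranslationHull : S → translationHull S) := by
  intro R
  rw [closure_subtype, ← range_comp]
  exact R.2

/-- If `S` is left and right reversible, then `AP(S)` has a left invariant mean. -/
theorem exists_isLIM_AP [Nonempty S] (hl : IsLeftReversible S) (hr : IsRightReversible S) :
    ∃ μ : AP S →L[ℂ] ℂ, IsLIM (AP S) μ := by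
  obtain ⟨t₀⟩ := ‹Nonempty S›
  have : Nonempty (translationHull S) := ⟨toTranslationHull t₀⟩
  obtain ⟨Λ, hΛ, hΛ1, hΛinv⟩ := exists_invariant_functional (M := translationHull S)
    (denseRange_toTranslationHull.exists_eq_of_reversible continuous_toTranslationHull
      (f := fun a b => a * b) continuous_mul toTranslationHull_mul hl)
    (denseRange_toTranslationHull.exists_eq_of_reversible continuous_toTranslationHull
      (o := fun s t => t * s) (f := fun a b => b * a) (continuous_mul.comp continuous_swap)
      (fun s t => toTranslationHull_mul t s) hr)
  -- S may lack an identity, so functions are evaluated at a fixed t₀. Replacing f by ℓ_s f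
  -- translates F f on the left by the image of s.
  let F : AP S → C(translationHull S, ℂ) := fun f =>
    ⟨fun R => (R.1 f : S →ᵇ ℂ) t₀, (continuous_eval_const (F := S →ᵇ ℂ) t₀).comp
      (continuous_subtype_val.comp ((continuous_apply f).comp continuous_subtype_val))⟩
  have hF : ∀ f R, F f R = (R.1 f : S →ᵇ ℂ) t₀ := fun _ _ => rfl
  let m : AP S →ₗ[ℂ] ℂ :=
    { toFun := fun f => Λ (F f)
      map_add' := fun f g => by
        rw [← map_add]
        congr 1
        ext R
        rw [ContinuousMap.add_apply, hF, map_add_of_mem_translationHull R.2]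
        rfl
      map_smul' := fun c f => by
        rw [RingHom.id_apply, ← map_smul]
        congr 1
        ext R
        rw [ContinuousMap.smul_apply, hF, map_smul_of_mem_translationHull R.2]
        rfl }
  have hm : ∀ f, m f = Λ (F f) := fun _ => rfl
  have hmb : ∀ f, ‖m f‖ ≤ 1 * ‖f‖ := by
    intro f
    rw [one_mul]
    refine (hΛ _).trans ((ContinuousMap.norm_le _ (norm_nonneg _)).2 fun R => ?_)
    refine ((R.1 f : S →ᵇ ℂ).norm_coe_le_norm t₀).trans ?_
    have h := (lipschitzWith_of_mem_translationHull R.2).dist_le_mul f 0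
    have h0 : R.1 0 = 0 := by
      simpa using map_smul_of_mem_translationHull R.2 0 0
    rwa [h0, dist_zero_right, dist_zero_right, NNReal.coe_one, one_mul] at h
  have hm1 : m ⟨1, one_mem_AP⟩ = 1 := by
    rw [hm, ← hΛ1]
    congr 1
    ext R
    rw [hF, map_one_of_mem_translationHull R.2]
    rfl
  refine ⟨m.mkContinuous 1 hmb, ⟨le_antisymm (m.mkContinuous_norm_le zero_le_one hmb) ?_,
    one_mem_AP, hm1⟩, fun s f h => ?_⟩
  · have h1 := (m.mkContinuous 1 hmb).le_opNorm ⟨1, one_mem_AP⟩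
    have h2 : ‖(⟨1, one_mem_AP⟩ : AP S)‖ ≤ 1 :=
      (BoundedContinuousFunction.norm_le zero_le_one).2 fun t => by simp
    rw [LinearMap.mkContinuous_apply, hm1, norm_one] at h1
    exact h1.trans (mul_le_of_le_one_right (norm_nonneg _) h2)
  · exact hΛinv (toTranslationHull s) (F f) _ fun R => rfl

end AlmostPeriodic

/-! ### Orbit functions belong to X. -/

section OrbitFunctions

variable {S : Type*} [Semigroup S] [TopologicalSpace S] [SeparatelyContinuousMul S]
variable {H : Type*} [NormedAddCommGroup H] [InnerProductSpace ℂ H] {C : Set H} {T : S → C → C}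

/-- The function `s ↦ φ (T_s x)` for a bounded orbit. -/
def orbitFunction {x : C} (hcont : Continuous fun s : S => T s x) {N : ℝ}
    (hN : ∀ s, ‖(T s x : H)‖ ≤ N) (φ : H →L[ℂ] ℂ) : S →ᵇ ℂ :=
  BoundedContinuousFunction.ofNormedAddCommGroup (fun s => φ (T s x : H)) (by fun_prop)
    (‖φ‖ * N) fun s => (φ.le_opNorm _).trans (by gcongr; exact hN s)

theorem IsWeaklyEquicontinuous.eventually_dist_lt {S : Type*} {T : S → C → C}
    (hT : IsWeaklyEquicontinuous T)
    (φ : H →L[ℂ] ℂ) (z : C) {ε : ℝ} (hε : 0 < ε) :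
    ∀ᶠ z' in @nhds C (weakTopology C) z, ∀ s, dist (φ (T s z' : H)) (φ (T s z : H)) < ε := by
  have hφ : Continuous fun v : WeakSpace ℂ H => φ ((toWeakSpace ℂ H).symm v) :=
    WeakBilin.eval_continuous (B := (topDualPairing ℂ H).flip) φ
  obtain ⟨U, hU, h⟩ := hT z {v | ‖φ ((toWeakSpace ℂ H).symm v)‖ < ε}
    (hφ.norm.continuousAt.eventually (gt_mem_nhds (by simpa using hε)))
  filter_upwards [hU] with z' hz' s
  have := h z' hz' s
  simpa [dist_eq_norm] using this

theorem orbitFunction_mem [CompleteSpace H]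
    (hrep : ∀ (s t : S) (x : C), T (s * t) x = T s (T t x))
    (hcont : ∀ x : C, Continuous fun s : S => T s x)
    (hb : ∀ x : C, ∃ N, ∀ s, ‖(T s x : H)‖ ≤ N) {X : Submodule ℂ (S →ᵇ ℂ)}
    (hX : X = ⊤ ∨ (X = LUC S ∧ IsWeaklyClosed C ∧ IsWeaklyJointlyContinuous T) ∨
      (X = AP S ∧ IsWeaklyClosed C ∧ IsWeaklyEquicontinuous T) ∨
      (X = WAP S ∧ IsWeaklyClosed C ∧ IsWeaklyQuasiEquicontinuous T))
    (x : C) (φ : H →L[ℂ] ℂ) : ∃ g : X, ∀ s, (g : S →ᵇ ℂ) s = φ (T s x : H) := by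
  obtain ⟨N, hN⟩ := hb x
  refine ⟨⟨orbitFunction (hcont x) hN φ, ?_⟩, fun s => rfl⟩
  have hK : IsWeaklyClosed C → ∀ z : C,
      @IsCompact C (weakTopology C) (@closure C (weakTopology C) (range fun s => T s z)) := by
    intro hC z
    obtain ⟨M, hM⟩ := hb z
    refine isCompact_weak_closure_of_bounded hC _ (N := M) ?_
    rintro _ ⟨s, rfl⟩
    exact hM s
  rcases hX with rfl | ⟨rfl, hC, hT⟩ | ⟨rfl, hC, hT⟩ | ⟨rfl, hC, hT⟩
  · trivial
  · exact @mem_LUC_of_continuous S _ _ _ C (weakTopology C) T (fun z => φ z) x hT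
      (continuous_weakTopology_apply φ) (hK hC x) (fun s t => hrep s t x) _ fun s => rfl
  · exact @mem_AP_of_equicontinuous S _ _ _ C (weakTopology C) T (fun z => φ z) x
      (fun z ε hε => hT.eventually_dist_lt φ z hε)
      (continuous_weakTopology_of_continuous (hcont x)) (hK hC x) (fun s t => hrep s t x) _
      fun s => rfl
  · exact @mem_WAP_of_quasiEquicontinuous S _ _ _ C (weakTopology C) T (fun z => φ z) x hT
      (continuous_weakTopology_apply φ) (continuous_weakTopology_of_continuous (hcont x))
      (hK hC) (fun s t => hrep s t x) _ fun s => rfl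

end OrbitFunctions

end

/-! ### The main theorem. -/

theorem mainTheorem2
    {S : Type*} [Semigroup S] [Nonempty S] [TopologicalSpace S] [T2Space S]
    [SeparatelyContinuousMul S]
    {H : Type*} [NormedAddCommGroup H] [InnerProductSpace ℂ H] [CompleteSpace H]
    (hS : IsRightReversible S)
    (C : Set H) (hC : IsClosed C)
    (T : S → C → C)
    (hrep : ∀ (s t : S) (x : C), T (s * t) x = T s (T t x))
    (hcont_left : ∀ x : C, Continuous fun s : S => T s x)
    (hcont_right : ∀ s : S, Continuous (T s))
    (hnonexp : ∀ (s : S) (x y : C), ‖(T s x : H) - (T s y : H)‖ ≤ ‖(x : H) - (y : H)‖)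
    (c : C) (hbdd : Bornology.IsBounded (range fun s : S => (T s c : H))) :
    (IsLeftReversible S → TopologicalSpace.SeparableSpace S → IsWeaklyClosed C →
        IsWeaklyEquicontinuous T → ∃ μ : AP S →L[ℂ] ℂ, IsLIM (AP S) μ) ∧
    ∀ (X : Submodule ℂ (S →ᵇ ℂ)),
      ((X = ⊤ ∧ Continuous[_, weakTopology C] fun s : S => T s c) ∨
        (X = LUC S ∧ IsWeaklyClosed C ∧ IsWeaklyJointlyContinuous T) ∨
        (X = AP S ∧ IsWeaklyClosed C ∧ IsWeaklyEquicontinuous T) ∨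
        (X = WAP S ∧ IsWeaklyClosed C ∧ IsWeaklyQuasiEquicontinuous T) ∨
        (X = AP S ∧ IsWeaklyClosed C ∧ IsLeftReversible S ∧ TopologicalSpace.SeparableSpace S ∧
          IsWeaklyEquicontinuous T)) →
      ∀ μ : X →L[ℂ] ℂ, IsLIM X μ →
        (attractivePoints T).Nonempty ∧ IsClosed (attractivePoints T) ∧
        Convex ℝ (attractivePoints T) ∧
        (∀ x : C, IsMeanPoint T X μ x (meanPoint T X μ x) ∧
          meanPoint T X μ x ∈ attractivePoints T) ∧
        (Convex ℝ C → ∃ x : C, ∀ s : S, T s x = x) ∧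
        (IsRIM X μ → ∀ x : C,
          ReversibleTendsto (fun t : S => metricProj (attractivePoints T) (T t x : H))
            (meanPoint T X μ x)) := by
  have hb : ∀ x : C, ∃ N, ∀ s, ‖(T s x : H)‖ ≤ N := by
    intro x
    obtain ⟨N, hN⟩ := hbdd.exists_norm_le
    refine ⟨‖(x : H) - c‖ + N, fun s => ?_⟩
    rw [← sub_add_cancel (T s x : H) (T s c : H)]
    exact (norm_add_le _ _).trans (add_le_add (hnonexp s x c) (hN _ ⟨s, rfl⟩))
  refine ⟨fun hl _ _ _ => exists_isLIM_AP hl hS, fun X hX μ hμ => ?_⟩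
  -- Case (5) is an instance of case (3).
  have hX' : X = ⊤ ∨ (X = LUC S ∧ IsWeaklyClosed C ∧ IsWeaklyJointlyContinuous T) ∨
      (X = AP S ∧ IsWeaklyClosed C ∧ IsWeaklyEquicontinuous T) ∨
      (X = WAP S ∧ IsWeaklyClosed C ∧ IsWeaklyQuasiEquicontinuous T) := by
    tauto
  have hmem := orbitFunction_mem hrep hcont_left hb hX'
  have htrans : ∀ (s : S) (f : S →ᵇ ℂ), f ∈ X → leftTranslate s f ∈ X := by
    rcases hX' with rfl | ⟨rfl, -⟩ | ⟨rfl, -⟩ | ⟨rfl, -⟩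
    · exact fun _ _ _ => trivial
    · exact fun s f => leftTranslate_mem_LUC s
    · exact fun s f => leftTranslate_mem_AP s
    · exact fun s f => leftTranslate_mem_WAP s
  have hpoint : ∀ x : C, IsMeanPoint T X μ x (meanPoint T X μ x) ∧
      meanPoint T X μ x ∈ attractivePoints T := by
    intro x
    obtain ⟨a, ha⟩ := exists_isMeanPoint hμ.1 x (hb x) (hmem x)
    exact ⟨ha.meanPoint, ha.meanPoint.mem_attractivePoints hμ htrans hrep hnonexp (hb x)⟩
  refine ⟨⟨_, (hpoint c).2⟩, isClosed_attractivePoints, convex_attractivePoints, hpoint,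
    fun hconv => exists_common_fixedPoint hC hconv ⟨_, c.2⟩ (hpoint c).2, fun hR x => ?_⟩
  exact reversibleTendsto_metricProj hR hrep (hcont_left x) hmem (hpoint x).1 (hpoint x).2 (hb x)
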